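/- Let $(M^{2n},\bar\omega)$ be a noncompact symplectic manifold with a compatible almost complex structure $J$, i.e. $\bar\omega(X,JX)>0$ for $X\neq 0$ and $\bar\omega(JX,JY)=\bar\omega(X,Y)$, and suppose that the Riemannian metric $\bar g(X,Y)=\bar\omega(X,JY)$ is complete. Put $d^c\rho=-d\rho\circ J$ and let $$\mathcal H=\{\rho\in C^\infty(M,\mathbb R)\ :\ \bar\omega_\rho:=\bar\omega+dd^c\rho \text{ tames } J\},\qquad \bar g_\rho(X,Y)=\tfrac12\big(\bar\omega_\rho(X,JY)+\bar\omega_\rho(Y,JX)\big)\quad(\rho\in\mathcal H),$$ where $\bar\omega_\rho$ tames $J$ if $\bar\omega_\rho(X,JX)>0$ for all $X\ne 0$. Let $F:\Sigma\to M$ be a smooth immersion of a surface $\Sigma$ without boundary, compact or not. For a compact set $K\subset\Sigma$ let $\mathcal A_K(\rho)$ be the area of $K$ in the induced metric $F^*\bar g_\rho$. An admissible variation of $\rho\in\mathcal H$ is a path $\varphi(t)\in\mathcal H$, $|t|<\varepsilon$, with $\varphi(0)=\rho$, smooth on $(-\varepsilon,\varepsilon)\times M$, such that $\varphi'(0)$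 and $\varphi''(0)$ have compact support in $M$. The second variation of area along it is $$\mathcal A''(0)=\limsup_{K\uparrow\Sigma}\ \frac{d^2}{dt^2}\Big|_{t=0}\mathcal A_K(\varphi(t))\in[-\infty,\infty],$$ the upper limit being taken along the compact subsets of $\Sigma$ directed by inclusion; if $\Sigma$ is closed this is the second derivative of the total area, and in general it is the integral over $\Sigma$ of the second derivative of the area density whenever that integral converges absolutely. One says that $\rho\in\mathcal H$ is a stable point of the area functional if $\mathcal A''(0)\ge 0$ for every admissible variation of $\rho$, and a compatible stable point if moreover $J$ is compatible with $\bar\omega_\rho$. If the area functional has a compatible stable point $\rho\in\mathcal H$, then $F$ is $J$-holomorphic: $J_{F(p)}$ maps $F_*(T_p\Sigma)$ onto itself for every $p\in\Sigma$. -/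

import Mathlib

open Set Filter Topology MeasureTheory
open scoped Manifold ContDiff

noncomputable section

namespace SymplecticArea

/-- The model space `ℝ^m` with its Euclidean norm. -/
abbrev E (m : ℕ) : Type := EuclideanSpace ℝ (Fin m)

/-! ### Tensors and differential forms on a boundaryless manifold -/

section Forms

variable {m : ℕ} {M : Type*} [TopologicalSpace M] [ChartedSpace (E m) M]

/-- The chart of `M` centred at `c`, as a map into `ℝ^m`. -/
abbrev chart (c : M) : PartialEquiv M (E m) := extChartAt (𝓡 m) c

variable (m M) in
/-- A (not necessarily smooth) differential `k`-form on `M`. -/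
abbrev DForm (k : ℕ) : Type _ :=
  (x : M) → TangentSpace (𝓡 m) x [⋀^Fin k]→L[ℝ] ℝ

/-- The expression of a `k`-form in the chart centred at `c`, i.e. its pullback by the inverse
of the chart. It is meaningful on the target of the chart. -/
def DForm.inChart {k : ℕ} (α : DForm m M k) (c : M) (y : E m) : E m [⋀^Fin k]→L[ℝ] ℝ :=
  (α ((chart (m := m) c).symm y)).compContinuousLinearMap (mfderiv (𝓡 m) (𝓡 m) (chart c).symm y)

/-- A `k`-form is smooth if all its expressions in charts are smooth. -/
def DForm.IsSmooth {k : ℕ} (α : DForm m M k) : Prop :=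
  ∀ c : M, ContDiffOn ℝ ∞ (α.inChart c) (chart (m := m) c).target

/-- The exterior derivative of a `k`-form, computed at `x` in the chart centred at `x`. -/
def DForm.d {k : ℕ} (α : DForm m M k) : DForm m M (k + 1) := fun x =>
  (extDeriv (α.inChart x) (chart (m := m) x x)).compContinuousLinearMap
    (mfderiv (𝓡 m) (𝓡 m) (chart (m := m) x) x)

/-- The expression in the chart centred at `c` of a field of endomorphisms of the tangent
bundle. It is meaningful on the target of the chart. -/
def endInChart (A : (x : M) → TangentSpace (𝓡 m) x →L[ℝ] TangentSpace (𝓡 m) x) (c : M)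
    (y : E m) : E m →L[ℝ] E m :=
  (mfderiv (𝓡 m) (𝓡 m) (chart (m := m) c) ((chart c).symm y)).comp
    ((A ((chart (m := m) c).symm y)).comp (mfderiv (𝓡 m) (𝓡 m) (chart c).symm y))

variable (m M) in
/-- An almost complex structure: a smooth field `J` of endomorphisms of the tangent bundle with
`J² = -1`. Smoothness means that the matrix of `J` is smooth in every chart. -/
structure AlmostComplexStructure where
  /-- The endomorphism of the tangent space at `x`. -/
  toFun : (x : M) → TangentSpace (𝓡 m) x →L[ℝ] TangentSpace (𝓡 m) x
  smooth : ∀ c : M, ContDiffOn ℝ ∞ (endInChart toFun c) (chart (m := m) c).target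
  sq : ∀ (x : M) (v : TangentSpace (𝓡 m) x), toFun x (toFun x v) = -v

instance : CoeFun (AlmostComplexStructure m M)
    (fun _ => (x : M) → TangentSpace (𝓡 m) x →L[ℝ] TangentSpace (𝓡 m) x) :=
  ⟨AlmostComplexStructure.toFun⟩

/-- A symplectic form: a smooth closed nondegenerate `2`-form. -/
structure IsSymplectic (Ω : DForm m M 2) : Prop where
  smooth : Ω.IsSmooth
  closed : ∀ x : M, Ω.d x = 0
  nondegenerate : ∀ (x : M) (v : TangentSpace (𝓡 m) x),
    (∀ w : TangentSpace (𝓡 m) x, Ω x ![v, w] = 0) → v = 0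

/-- `Ω` tames `J`: `Ω(X, JX) > 0` for `X ≠ 0`. -/
def Tames (Ω : DForm m M 2) (J : AlmostComplexStructure m M) : Prop :=
  ∀ (x : M) (v : TangentSpace (𝓡 m) x), v ≠ 0 → 0 < Ω x ![v, J x v]

/-- `J` is compatible with `Ω`: it is tamed by `Ω` and `Ω(JX, JY) = Ω(X, Y)`. -/
def Compatible (Ω : DForm m M 2) (J : AlmostComplexStructure m M) : Prop :=
  Tames Ω J ∧ ∀ (x : M) (v w : TangentSpace (𝓡 m) x), Ω x ![J x v, J x w] = Ω x ![v, w]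

/-- The `1`-form `d^c ρ = √-1 (∂bar ρ - ∂ ρ)`. Since `∂ρ = (dρ - √-1 dρ ∘ J) / 2` and
`∂bar ρ = (dρ + √-1 dρ ∘ J) / 2` are the `(1,0)` and `(0,1)` parts of `dρ`, this is
`-dρ ∘ J`. -/
def dc (J : AlmostComplexStructure m M) (ρ : M → ℝ) : DForm m M 1 := fun x =>
  ContinuousAlternatingMap.ofSubsingleton ℝ (TangentSpace (𝓡 m) x) ℝ (0 : Fin 1)
    (-((mfderiv (𝓡 m) 𝓘(ℝ, ℝ) ρ x : TangentSpace (𝓡 m) x →L[ℝ] ℝ).comp (J x)))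

/-- The form `Ω_ρ = Ω + d d^c ρ`. -/
def deform (Ω : DForm m M 2) (J : AlmostComplexStructure m M) (ρ : M → ℝ) : DForm m M 2 :=
  fun x => Ω x + (dc J ρ).d x

/-- The symmetric tensor `g(X, Y) = (Ω(X, JY) + Ω(Y, JX)) / 2`. It is a Riemannian metric when
`Ω` tames `J`, and it equals `Ω(X, JY)` when `J` is compatible with `Ω`. -/
def metric (Ω : DForm m M 2) (J : AlmostComplexStructure m M) (x : M)
    (v w : TangentSpace (𝓡 m) x) : ℝ :=
  (Ω x ![v, J x w] + Ω x ![w, J x v]) / 2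

/-- The space `H` of smooth functions `ρ` such that `Ω + d d^c ρ` tames `J`. -/
def potentials (Ω : DForm m M 2) (J : AlmostComplexStructure m M) : Set (M → ℝ) :=
  {ρ | ContMDiff (𝓡 m) 𝓘(ℝ, ℝ) ∞ ρ ∧ Tames (deform Ω J ρ) J}

/-- The distance of a Riemannian metric `g`: the infimum of the `g`-lengths of `C¹` paths. -/
def riemDist (g : (x : M) → TangentSpace (𝓡 m) x → TangentSpace (𝓡 m) x → ℝ) (x y : M) : ENNReal :=
  letI : ∀ z : M, ENorm (TangentSpace (𝓡 m) z) :=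
    fun z => ⟨fun v => ENNReal.ofReal (Real.sqrt (g z v v))⟩
  Manifold.riemannianEDist (𝓡 m) x y

/-- Completeness of the Riemannian metric `g`: sequences which are Cauchy for the distance of `g`
converge in `M`. -/
def IsCompleteMetric (g : (x : M) → TangentSpace (𝓡 m) x → TangentSpace (𝓡 m) x → ℝ) : Prop :=
  ∀ u : ℕ → M,
    (∀ ε : ENNReal, 0 < ε → ∃ N : ℕ, ∀ k l : ℕ, N ≤ k → N ≤ l → riemDist g (u k) (u l) < ε) →
    ∃ x : M, Tendsto u atTop (𝓝 x)

end Forms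

/-! ### Immersed surfaces, area, stability -/

section Surface

variable {m : ℕ} {M : Type*} [TopologicalSpace M] [ChartedSpace (E m) M]
variable {S : Type*} [TopologicalSpace S] [ChartedSpace (E 2) S]

/-- `F` is a smooth immersion of the surface `S` in `M`. -/
def IsSmoothImmersion (F : S → M) : Prop :=
  ContMDiff (𝓡 2) (𝓡 m) ∞ F ∧ ∀ p : S, Function.Injective (mfderiv (𝓡 2) (𝓡 m) F p)

/-- `F` is `J`-holomorphic: `J` maps each `F_* (T_p S)` onto itself. -/
def IsJHolomorphic (J : AlmostComplexStructure m M) (F : S → M) : Prop :=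
  ∀ p : S, J (F p) '' range (mfderiv (𝓡 2) (𝓡 m) F p) = range (mfderiv (𝓡 2) (𝓡 m) F p)

/-- The pullback by `F` of a field of bilinear forms on `M`. -/
def pullbackMetric (F : S → M)
    (g : (x : M) → TangentSpace (𝓡 m) x → TangentSpace (𝓡 m) x → ℝ) (p : S)
    (v w : TangentSpace (𝓡 2) p) : ℝ :=
  g (F p) (mfderiv (𝓡 2) (𝓡 m) F p v) (mfderiv (𝓡 2) (𝓡 m) F p w)

/-- The area density `√(det (g_ij))` of the metric `g` on `S`, in the chart centred at `c`. -/
def areaDensity (g : (p : S) → TangentSpace (𝓡 2) p → TangentSpace (𝓡 2) p → ℝ)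
    (c : S) (y : E 2) : ℝ :=
  Real.sqrt (Matrix.det (Matrix.of fun i j : Fin 2 =>
    g ((chart c).symm y)
      (mfderiv (𝓡 2) (𝓡 2) (chart c).symm y (EuclideanSpace.single i (1 : ℝ)))
      (mfderiv (𝓡 2) (𝓡 2) (chart c).symm y (EuclideanSpace.single j (1 : ℝ)))))

variable (S) in
/-- A smooth partition of unity of `S` subordinate to its charts. -/
def chartPartition [T2Space S] [SigmaCompactSpace S] [IsManifold (𝓡 2) ∞ S] :
    SmoothPartitionOfUnity S (𝓡 2) S univ :=
  (SmoothPartitionOfUnity.exists_isSubordinate_chartAt_source (𝓡 2) S).choose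

/-- The `g`-area of a region `K` of `S`: the integral of `√(det (g_ij))` over `K`, defined as
usual by a partition of unity subordinate to charts (by the change of variables formula the
value does not depend on the partition). -/
def area [T2Space S] [SigmaCompactSpace S] [IsManifold (𝓡 2) ∞ S]
    (g : (p : S) → TangentSpace (𝓡 2) p → TangentSpace (𝓡 2) p → ℝ) (K : Set S) : ENNReal :=
  ∑' c : S, ∫⁻ y in (chart (m := 2) c).target ∩ (chart c).symm ⁻¹' K,
    ENNReal.ofReal (chartPartition S c ((chart c).symm y) * areaDensity g c y)

/-- The area functional on potentials, for the region `K` of the surface: the area of `K` for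
the metric induced by `F` from the metric of `Ω + d d^c ρ`. For `K` compact it is finite; for a
closed surface and `K = S` it is the total area. -/
def areaFunctional [T2Space S] [SigmaCompactSpace S] [IsManifold (𝓡 2) ∞ S]
    (Ω : DForm m M 2) (J : AlmostComplexStructure m M) (F : S → M) (K : Set S)
    (ρ : M → ℝ) : ℝ :=
  (area (pullbackMetric F (metric (deform Ω J ρ) J)) K).toReal

/-- An admissible variation of `ρ`: a smooth path `φ(t)`, `|t| < ε`, of elements of `H`, with
`φ(0) = ρ`, such that the test functions `φ'(0)` and `φ''(0)` have compact support. -/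
structure IsVariation (Ω : DForm m M 2) (J : AlmostComplexStructure m M) (ρ : M → ℝ)
    (ε : ℝ) (φ : ℝ → M → ℝ) : Prop where
  smooth : ContMDiffOn (𝓘(ℝ, ℝ).prod (𝓡 m)) 𝓘(ℝ, ℝ) ∞ (fun p : ℝ × M => φ p.1 p.2)
    (Ioo (-ε) ε ×ˢ univ)
  mem : ∀ t ∈ Ioo (-ε) ε, φ t ∈ potentials Ω J
  zero : φ 0 = ρ
  compact_first : HasCompactSupport fun x : M => deriv (fun t : ℝ => φ t x) 0
  compact_second : HasCompactSupport fun x : M => iteratedDeriv 2 (fun t : ℝ => φ t x) 0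

/-- The second variation of area along the path `φ` of potentials, as an extended real.
The total area of a noncompact surface may be infinite, so the second derivative at `t = 0` is
taken of the areas of compact regions `K`, and `K` then exhausts the surface: we take the upper
limit along the compact subsets of `S` directed by inclusion. For a closed surface this is the
second derivative of the total area. In general it is the integral over `S` of the second
derivative of the area density, whenever that integral converges absolutely; in particular, if
the supports of `φ'(0)` and `φ''(0)` have compact preimage in `S`, it is the second derivative
of the area of any compact region containing that preimage. -/
def secondVariation [T2Space S] [SigmaCompactSpace S] [IsManifold (𝓡 2) ∞ S]
    (Ω : DForm m M 2) (J : AlmostComplexStructure m M) (F : S → M) (φ : ℝ → M → ℝ) : EReal :=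
  limsup (fun K : TopologicalSpace.Compacts S =>
    ((iteratedDeriv 2 (fun t : ℝ => areaFunctional Ω J F (K : Set S) (φ t)) 0 : ℝ) : EReal)) atTop

/-- `ρ ∈ H` is a stable point of the area functional: the second variation of area is nonnegative
along all admissible variations of `ρ`. -/
def IsStablePoint [T2Space S] [SigmaCompactSpace S] [IsManifold (𝓡 2) ∞ S]
    (Ω : DForm m M 2) (J : AlmostComplexStructure m M) (F : S → M) (ρ : M → ℝ) : Prop :=
  ρ ∈ potentials Ω J ∧
    ∀ (ε : ℝ) (φ : ℝ → M → ℝ), 0 < ε → IsVariation Ω J ρ ε φ →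
      0 ≤ secondVariation Ω J F φ

/-- A stable point `ρ` is a compatible stable point if `J` is compatible with `Ω + d d^c ρ`. -/
def IsCompatibleStablePoint [T2Space S] [SigmaCompactSpace S] [IsManifold (𝓡 2) ∞ S]
    (Ω : DForm m M 2) (J : AlmostComplexStructure m M) (F : S → M) (ρ : M → ℝ) : Prop :=
  IsStablePoint Ω J F ρ ∧ Compatible (deform Ω J ρ) J

end Surface

end SymplecticArea

end

/-! Along an affine path ρ + t f the form Ω + dd^c(ρ + t f) is affine in t. In a chart of the
surface the induced metric is therefore a pencil G + tH of symmetric 2 × 2 matrices, and the area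
density is √(a + bt + ct²) with a = det G > 0 and c = det H. Its second derivative at 0 is (4ac −
b²)/(4a^{3/2}). Since G is definite, the discriminant b² − 4ac is nonnegative
(`pencil_discrim_nonneg`), so an affine variation has nonpositive second area density at every point
of the surface. Stability fails as soon as one compactly supported f makes this density negative at
one point.

Suppose a tangent plane, spanned by X and Y, is not J-invariant. Then Y is not in the span of X and
JX, and some linear form l kills X and JX but not Y. Cutting off l²/2 in a chart gives f with dd^c
f(v, Jv) = l(v)² + l(Jv)² at that point (`exists_test_function`). Now H has a zero XX entry and a
positive YY entry, which makes the discriminant strictly positive (`pencil_discrim_pos`).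

Taming is an open condition over the compact support of f, so ρ + t f remains a potential for small
t (`exists_add_smul_mem_potentials`). Because the density is nonpositive everywhere, no other part
of the surface, including other sheets through the support of f, can compensate the loss: the upper
limit over compact regions is negative (`secondVariation_neg`). -/

noncomputable section

namespace SymplecticArea

/-! ### Changes of chart, exterior derivative and dd^c. -/

section Charts

variable {m : ℕ} {M : Type*} [TopologicalSpace M] [ChartedSpace (E m) M] [IsManifold (𝓡 m) ∞ M]

lemma mfderiv_chart_mfderiv_symm (c : M) {y : E m} (hy : y ∈ (chart (m := m) c).target)
    (v : E m) :
    (mfderiv (𝓡 m) (𝓡 m) (chart (m := m) c) ((chart (m := m) c).symm y)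
      (mfderiv (𝓡 m) (𝓡 m) (chart (m := m) c).symm y v : TangentSpace (𝓡 m) _) : E m) = v := by
  have h := mfderiv_extChartAt_comp_mfderivWithin_extChartAt_symm (I := 𝓡 m) hy
  rw [ModelWithCorners.Boundaryless.range_eq_univ, mfderivWithin_univ] at h
  exact DFunLike.congr_fun h v

lemma mfderiv_symm_mfderiv_chart (c : M) {y : E m} (hy : y ∈ (chart (m := m) c).target)
    (v : TangentSpace (𝓡 m) ((chart (m := m) c).symm y)) :
    mfderiv (𝓡 m) (𝓡 m) (chart (m := m) c).symm y
      (mfderiv (𝓡 m) (𝓡 m) (chart (m := m) c) ((chart (m := m) c).symm y) v) = v := by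
  have h := mfderivWithin_extChartAt_symm_comp_mfderiv_extChartAt (I := 𝓡 m) hy
  rw [ModelWithCorners.Boundaryless.range_eq_univ, mfderivWithin_univ] at h
  exact DFunLike.congr_fun h v

lemma mdifferentiableAt_symm (c : M) {y : E m} (hy : y ∈ (chart (m := m) c).target) :
    MDifferentiableAt (𝓡 m) (𝓡 m) (chart (m := m) c).symm y :=
  ((contMDiffOn_extChartAt_symm (n := ∞) c).contMDiffAt
    ((isOpen_extChartAt_target c).mem_nhds hy)).mdifferentiableAt (by simp)

lemma mdifferentiableAt_chart (c : M) {x : M} (hx : x ∈ (chart (m := m) c).source) :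
    MDifferentiableAt (𝓡 m) (𝓡 m) (chart (m := m) c) x :=
  mdifferentiableAt_extChartAt (by simpa using hx)

lemma contDiffAt_transition (c c' : M) {y : E m} (hy : y ∈ (chart (m := m) c).target)
    (hy' : (chart (m := m) c).symm y ∈ (chart (m := m) c').source) :
    ContDiffAt ℝ ∞ (chart (m := m) c' ∘ (chart (m := m) c).symm) y := by
  have h := contDiffWithinAt_ext_coord_change (I := 𝓡 m) (n := ∞) c' c (y := y)
    (by rw [PartialEquiv.trans_source]; exact ⟨hy, hy'⟩)
  rw [ModelWithCorners.Boundaryless.range_eq_univ] at h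
  exact h

lemma fderiv_transition (c c' : M) {y : E m} (hy : y ∈ (chart (m := m) c).target)
    (hy' : (chart (m := m) c).symm y ∈ (chart (m := m) c').source) (v : E m) :
    fderiv ℝ (chart (m := m) c' ∘ (chart (m := m) c).symm) y v =
      mfderiv (𝓡 m) (𝓡 m) (chart (m := m) c') ((chart (m := m) c).symm y)
        (mfderiv (𝓡 m) (𝓡 m) (chart (m := m) c).symm y v) := by
  have h := mfderiv_comp y (mdifferentiableAt_chart c' hy') (mdifferentiableAt_symm c hy)
  rw [← mfderiv_eq_fderiv, h]
  rfl

lemma mfderiv_symm_transition (c c' : M) {y : E m} (hy : y ∈ (chart (m := m) c).target)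
    (hy' : (chart (m := m) c).symm y ∈ (chart (m := m) c').source) (v : E m) :
    (mfderiv (𝓡 m) (𝓡 m) (chart (m := m) c').symm
      ((chart (m := m) c' ∘ (chart (m := m) c).symm) y)
      (fderiv ℝ (chart (m := m) c' ∘ (chart (m := m) c).symm) y v) : E m) =
      (mfderiv (𝓡 m) (𝓡 m) (chart (m := m) c).symm y v : E m) := by
  rw [fderiv_transition c c' hy hy']
  -- Stated for a free point x, so that the base point of the tangent space need not be rewritten
  -- inside a dependent type.
  have key : ∀ x : M, x ∈ (chart (m := m) c').source → ∀ w : TangentSpace (𝓡 m) x,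
      (mfderiv (𝓡 m) (𝓡 m) (chart (m := m) c').symm (chart (m := m) c' x)
        (mfderiv (𝓡 m) (𝓡 m) (chart (m := m) c') x w) : E m) = (w : E m) := by
    intro x hx w
    have h := mfderivWithin_extChartAt_symm_comp_mfderiv_extChartAt' (I := 𝓡 m) hx
    rw [ModelWithCorners.Boundaryless.range_eq_univ, mfderivWithin_univ] at h
    exact DFunLike.congr_fun h w
  exact key _ hy' _

lemma eventually_transition (c c' : M) {y : E m} (hy : y ∈ (chart (m := m) c).target)
    (hy' : (chart (m := m) c).symm y ∈ (chart (m := m) c').source) :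
    ∀ᶠ z in 𝓝 y, z ∈ (chart (m := m) c).target ∧
      (chart (m := m) c).symm z ∈ (chart (m := m) c').source :=
  Filter.Eventually.and ((isOpen_extChartAt_target c).mem_nhds hy) <|
    (mdifferentiableAt_symm c hy).continuousAt.eventually
      ((isOpen_extChartAt_source c').mem_nhds hy')

omit [IsManifold (𝓡 m) ∞ M] in
-- All tangent spaces are definitionally ℝ^m, so values of a form at two propositionally equal
-- points can be compared without a cast.
lemma DForm.apply_congr {k : ℕ} (α : DForm m M k) {x x' : M} (h : x = x')
    (v w : Fin k → E m) (hvw : v = w) :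
    (α x : E m [⋀^Fin k]→L[ℝ] ℝ) v = (α x' : E m [⋀^Fin k]→L[ℝ] ℝ) w := by
  subst h; subst hvw; rfl

lemma DForm.inChart_transition {k : ℕ} (α : DForm m M k) (c c' : M) {y : E m}
    (hy : y ∈ (chart (m := m) c).target)
    (hy' : (chart (m := m) c).symm y ∈ (chart (m := m) c').source) :
    α.inChart c y =
      (α.inChart c' ((chart (m := m) c' ∘ (chart (m := m) c).symm) y)).compContinuousLinearMap
        (fderiv ℝ (chart (m := m) c' ∘ (chart (m := m) c).symm) y) := by
  ext v
  refine α.apply_congr ((chart (m := m) c').left_inv hy').symm _ _ ?_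
  funext i
  exact (mfderiv_symm_transition c c' hy hy' (v i)).symm

/-- The definition of `DForm.d` uses a different chart at each point. Naturality of the exterior
derivative under the transition map shows that any one chart computes it on its whole target. -/
lemma DForm.d_inChart {k : ℕ} {α : DForm m M k} (hα : α.IsSmooth) (c : M) {y : E m}
    (hy : y ∈ (chart (m := m) c).target) :
    α.d.inChart c y = extDeriv (α.inChart c) y := by
  set x : M := (chart (m := m) c).symm y with hx
  have hxs : x ∈ (chart (m := m) x).source := mem_extChartAt_source x
  have hpull : α.inChart c =ᶠ[𝓝 y] fun z =>
      (α.inChart x ((chart (m := m) x ∘ (chart (m := m) c).symm) z)).compContinuousLinearMap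
        (fderiv ℝ (chart (m := m) x ∘ (chart (m := m) c).symm) z) := by
    filter_upwards [eventually_transition c x hy hxs] with z hz
    exact α.inChart_transition c x hz.1 hz.2
  rw [hpull.extDeriv_eq, extDeriv_pullback (r := ∞) _ (contDiffAt_transition c x hy hxs)
    (by rw [minSmoothness_of_isRCLikeNormedField]; exact ENat.LEInfty.out)]
  · ext v
    have : ∀ w, fderiv ℝ (chart (m := m) x ∘ (chart (m := m) c).symm) y w = _ :=
      fun w => fderiv_transition c x hy hxs w
    change (extDeriv (α.inChart x) (chart (m := m) x x)) _ = (extDeriv (α.inChart x) _) _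
    congr 1
    funext i
    exact (this (v i)).symm
  · exact ((hα x).contDiffAt ((isOpen_extChartAt_target x).mem_nhds
      ((chart (m := m) x).map_source hxs))).differentiableAt (by simp)

lemma DForm.IsSmooth.d {k : ℕ} {α : DForm m M k} (hα : α.IsSmooth) : α.d.IsSmooth := by
  intro c
  refine ContDiffOn.congr ?_ fun y hy => DForm.d_inChart hα c hy
  exact (ContinuousAlternatingMap.alternatizeUncurryFinCLM ℝ (E m) ℝ).contDiff.comp_contDiffOn
    ((hα c).fderiv_of_isOpen (isOpen_extChartAt_target c) (m := ∞) le_rfl)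

omit [IsManifold (𝓡 m) ∞ M] in
lemma DForm.IsSmooth.add {k : ℕ} {α β : DForm m M k} (hα : α.IsSmooth) (hβ : β.IsSmooth) :
    DForm.IsSmooth (fun x => α x + β x) :=
  fun c => ((hα c).add (hβ c)).congr fun y _ => by ext v; rfl

omit [IsManifold (𝓡 m) ∞ M] in
lemma DForm.d_add_smul {k : ℕ} {α β : DForm m M k} (hα : α.IsSmooth) (hβ : β.IsSmooth)
    (t : ℝ) (x : M) : DForm.d (fun x => α x + t • β x) x = α.d x + t • β.d x := by
  have hx : chart (m := m) x x ∈ (chart (m := m) x).target := mem_extChartAt_target x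
  have hd : ∀ {γ : DForm m M k}, γ.IsSmooth →
      DifferentiableAt ℝ (γ.inChart x) (chart (m := m) x x) := fun hγ =>
    ((hγ x).contDiffAt ((isOpen_extChartAt_target x).mem_nhds hx)).differentiableAt (by simp)
  have h : DForm.inChart (fun x => α x + t • β x) x = α.inChart x + t • β.inChart x := by
    funext y; ext v; rfl
  unfold DForm.d
  rw [h, extDeriv_add (hd hα) ((hd hβ).const_smul t), extDeriv_smul]
  ext v; rfl

/-- The chart derivative in `endInChart` and the derivative of the inverse chart in d(ρ ∘ chart⁻¹)
cancel. -/
lemma dc_inChart (J : AlmostComplexStructure m M) {ρ : M → ℝ}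
    (hρ : ContMDiff (𝓡 m) 𝓘(ℝ, ℝ) ∞ ρ) (c : M) {y : E m} (hy : y ∈ (chart (m := m) c).target) :
    (dc J ρ).inChart c y = ContinuousAlternatingMap.ofSubsingletonLIE (𝕜 := ℝ) (0 : Fin 1)
      (-((fderiv ℝ (ρ ∘ (chart (m := m) c).symm) y).comp (endInChart J c y))) := by
  ext v
  have h := mfderiv_comp y (hρ.mdifferentiableAt (by simp)) (mdifferentiableAt_symm c hy)
  rw [mfderiv_eq_fderiv] at h
  have h2 : ∀ w : E m, fderiv ℝ (ρ ∘ (chart (m := m) c).symm) y w =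
      mfderiv (𝓡 m) 𝓘(ℝ, ℝ) ρ ((chart (m := m) c).symm y)
        (mfderiv (𝓡 m) (𝓡 m) (chart (m := m) c).symm y w) := fun w => DFunLike.congr_fun h w
  have h3 := mfderiv_symm_mfderiv_chart c hy (J ((chart (m := m) c).symm y)
    (mfderiv (𝓡 m) (𝓡 m) (chart (m := m) c).symm y (v 0)))
  change -(mfderiv (𝓡 m) 𝓘(ℝ, ℝ) ρ ((chart (m := m) c).symm y) (J ((chart (m := m) c).symm y)
    (mfderiv (𝓡 m) (𝓡 m) (chart (m := m) c).symm y (v 0)))) =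
    -(fderiv ℝ (ρ ∘ (chart (m := m) c).symm) y (endInChart J c y (v 0)))
  rw [h2]
  congr 2
  exact h3.symm

lemma contDiffOn_comp_symm {ρ : M → ℝ} (hρ : ContMDiff (𝓡 m) 𝓘(ℝ, ℝ) ∞ ρ) (c : M) :
    ContDiffOn ℝ ∞ (ρ ∘ (chart (m := m) c).symm) (chart (m := m) c).target :=
  contMDiffOn_iff_contDiffOn.1 (hρ.comp_contMDiffOn (contMDiffOn_extChartAt_symm c))

lemma dc_isSmooth (J : AlmostComplexStructure m M) {ρ : M → ℝ}
    (hρ : ContMDiff (𝓡 m) 𝓘(ℝ, ℝ) ∞ ρ) : (dc J ρ).IsSmooth := by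
  intro c
  refine ContDiffOn.congr ?_ fun y hy => dc_inChart J hρ c hy
  refine (LinearIsometryEquiv.contDiff _).comp_contDiffOn (ContDiffOn.neg ?_)
  exact ((contDiffOn_comp_symm hρ c).fderiv_of_isOpen (isOpen_extChartAt_target c)
    (m := ∞) le_rfl).clm_comp (J.smooth c)

omit [IsManifold (𝓡 m) ∞ M] in
lemma dc_add_smul (J : AlmostComplexStructure m M) {ρ f : M → ℝ}
    (hρ : ContMDiff (𝓡 m) 𝓘(ℝ, ℝ) ∞ ρ) (hf : ContMDiff (𝓡 m) 𝓘(ℝ, ℝ) ∞ f) (t : ℝ) (x : M) :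
    dc J (fun x => ρ x + t * f x) x = dc J ρ x + t • dc J f x := by
  ext v
  have hρx := (hρ.mdifferentiableAt (by simp) (x := x)).hasMFDerivAt
  have hfx := (hf.mdifferentiableAt (by simp) (x := x)).hasMFDerivAt
  have h1 := HasMFDerivAt.add hρx (hfx.const_smul t)
  let D : (M → ℝ) → (TangentSpace (𝓡 m) x →L[ℝ] ℝ) := fun g => mfderiv (𝓡 m) 𝓘(ℝ, ℝ) g x
  have h2 : ∀ w, D (fun x => ρ x + t * f x) w = D ρ w + t * D f w :=
    fun w => DFunLike.congr_fun h1.mfderiv w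
  change -(D (fun x => ρ x + t * f x) (J x (v 0))) =
    -(D ρ (J x (v 0))) + t * -(D f (J x (v 0)))
  rw [h2]; ring

lemma deform_add_smul (Ω : DForm m M 2) (J : AlmostComplexStructure m M) {ρ f : M → ℝ}
    (hρ : ContMDiff (𝓡 m) 𝓘(ℝ, ℝ) ∞ ρ) (hf : ContMDiff (𝓡 m) 𝓘(ℝ, ℝ) ∞ f) (t : ℝ) (x : M) :
    deform Ω J (fun x => ρ x + t * f x) x = deform Ω J ρ x + t • (dc J f).d x := by
  have h : dc J (fun x => ρ x + t * f x) = fun x => dc J ρ x + t • dc J f x :=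
    funext (dc_add_smul J hρ hf t)
  unfold deform
  rw [h, DForm.d_add_smul (dc_isSmooth J hρ) (dc_isSmooth J hf), add_assoc]

lemma deform_isSmooth {Ω : DForm m M 2} (hΩ : Ω.IsSmooth) (J : AlmostComplexStructure m M)
    {ρ : M → ℝ} (hρ : ContMDiff (𝓡 m) 𝓘(ℝ, ℝ) ∞ ρ) : (deform Ω J ρ).IsSmooth :=
  hΩ.add (dc_isSmooth J hρ).d

/-- Locality: f vanishes on a neighbourhood of x, hence so does the chart expression of d^c f. -/
lemma d_dc_eq_zero (J : AlmostComplexStructure m M) {f : M → ℝ}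
    (hf : ContMDiff (𝓡 m) 𝓘(ℝ, ℝ) ∞ f) {x : M} (hx : x ∉ tsupport f) : (dc J f).d x = 0 := by
  have hxs : x ∈ (chart (m := m) x).source := mem_extChartAt_source x
  have hxt := (chart (m := m) x).map_source hxs
  have hz : ∀ᶠ x' in 𝓝 x, x' ∉ tsupport f := (isClosed_tsupport f).isOpen_compl.mem_nhds hx
  have hev : ∀ᶠ y in 𝓝 (chart (m := m) x x),
      y ∈ (chart (m := m) x).target ∧ (chart (m := m) x).symm y ∉ tsupport f := by
    refine Filter.Eventually.and ((isOpen_extChartAt_target x).mem_nhds hxt)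
      ((mdifferentiableAt_symm x hxt).continuousAt.eventually (p := (· ∉ tsupport f)) ?_)
    rwa [(chart (m := m) x).left_inv hxs]
  have h0 : (dc J f).inChart x =ᶠ[𝓝 (chart (m := m) x x)] fun _ => 0 := by
    filter_upwards [hev.eventually_nhds] with y hy
    have h1 : f ∘ (chart (m := m) x).symm =ᶠ[𝓝 y] fun _ => 0 := by
      filter_upwards [hy] with z hz
      exact image_eq_zero_of_notMem_tsupport (f := f) hz.2
    rw [dc_inChart J hf x hy.self_of_nhds.1, h1.fderiv_eq]
    ext v
    simp [ContinuousAlternatingMap.ofSubsingletonLIE]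
  unfold DForm.d
  rw [h0.extDeriv_eq]
  ext v
  change extDeriv (fun _ => (0 : E m [⋀^Fin 1]→L[ℝ] ℝ)) _ _ = 0
  simp [extDeriv, ContinuousAlternatingMap.alternatizeUncurryFin_apply]

end Charts

/-! ### Symmetrised forms and pencils of 2 × 2 symmetric matrices. -/

section LinearAlgebra

variable {V : Type*} [AddCommGroup V] [Module ℝ V] [TopologicalSpace V]

lemma alternating_swap (σ : V [⋀^Fin 2]→L[ℝ] ℝ) (v w : V) : σ ![v, w] = -σ ![w, v] := by
  have h := σ.toAlternatingMap.map_swap ![w, v] (show (0 : Fin 2) ≠ 1 by decide)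
  have h2 : (![w, v] : Fin 2 → V) ∘ Equiv.swap 0 1 = ![v, w] := by
    funext i; fin_cases i <;> simp
  rw [h2] at h
  exact h

lemma alternating_add_left (σ : V [⋀^Fin 2]→L[ℝ] ℝ) (u v w : V) :
    σ ![u + v, w] = σ ![u, w] + σ ![v, w] := σ.vecCons_add ![w] u v

lemma alternating_smul_left (σ : V [⋀^Fin 2]→L[ℝ] ℝ) (a : ℝ) (v w : V) :
    σ ![a • v, w] = a * σ ![v, w] := σ.vecCons_smul ![w] a v

lemma alternating_add_right (σ : V [⋀^Fin 2]→L[ℝ] ℝ) (u v w : V) :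
    σ ![w, u + v] = σ ![w, u] + σ ![w, v] := by
  rw [alternating_swap σ w, alternating_add_left, alternating_swap σ w u, alternating_swap σ w v]
  ring

lemma alternating_smul_right (σ : V [⋀^Fin 2]→L[ℝ] ℝ) (a : ℝ) (v w : V) :
    σ ![w, a • v] = a * σ ![w, v] := by
  rw [alternating_swap σ w, alternating_smul_left, alternating_swap σ w v]
  ring

/-- The symmetric part of the bilinear form `σ(v, A w)`. -/
def symForm (σ : V [⋀^Fin 2]→L[ℝ] ℝ) (A : V →L[ℝ] V) : LinearMap.BilinForm ℝ V :=
  LinearMap.mk₂ ℝ (fun v w => (σ ![v, A w] + σ ![w, A v]) / 2)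
    (fun u v w => by
      simp only [map_add, alternating_add_left, alternating_add_right]; ring)
    (fun a v w => by
      simp only [map_smul, alternating_smul_left, alternating_smul_right, smul_eq_mul]; ring)
    (fun u v w => by
      simp only [map_add, alternating_add_left, alternating_add_right]; ring)
    (fun a v w => by
      simp only [map_smul, alternating_smul_left, alternating_smul_right, smul_eq_mul]; ring)

lemma symForm_apply (σ : V [⋀^Fin 2]→L[ℝ] ℝ) (A : V →L[ℝ] V) (v w : V) :
    symForm σ A v w = (σ ![v, A w] + σ ![w, A v]) / 2 := rfl

lemma symForm_comm (σ : V [⋀^Fin 2]→L[ℝ] ℝ) (A : V →L[ℝ] V) (v w : V) :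
    symForm σ A v w = symForm σ A w v := by
  simp only [symForm_apply, add_comm]

lemma symForm_self (σ : V [⋀^Fin 2]→L[ℝ] ℝ) (A : V →L[ℝ] V) (v : V) :
    symForm σ A v v = σ ![v, A v] := by
  rw [symForm_apply]; ring

lemma symForm_add_smul (σ η : V [⋀^Fin 2]→L[ℝ] ℝ) (A : V →L[ℝ] V) (t : ℝ) (v w : V) :
    symForm (σ + t • η) A v w = symForm σ A v w + t * symForm η A v w := by
  simp only [symForm_apply, ContinuousAlternatingMap.add_apply, ContinuousAlternatingMap.smul_apply,
    smul_eq_mul]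
  ring

omit [TopologicalSpace V] in
-- Strict Cauchy–Schwarz: evaluate B on the component of Y orthogonal to X and multiply by B(X, X).
lemma gram_det_pos (B : LinearMap.BilinForm ℝ V) (hB : ∀ v w, B v w = B w v)
    (hpos : ∀ v, v ≠ 0 → 0 < B v v) {X Y : V} (hX : X ≠ 0) (hXY : ∀ a : ℝ, Y ≠ a • X) :
    0 < B X X * B Y Y - B X Y * B Y X := by
  have h1 := hpos X hX
  have h2 := hpos (Y - (B X Y / B X X) • X) (sub_ne_zero.2 (hXY _))
  have h3 : B (Y - (B X Y / B X X) • X) (Y - (B X Y / B X X) • X) =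
      B Y Y - B X Y * B Y X / B X X := by
    simp only [map_sub, map_smul, LinearMap.sub_apply, LinearMap.smul_apply, smul_eq_mul]
    rw [hB Y X]
    field_simp
    ring
  rw [h3] at h2
  have h4 := mul_pos h1 h2
  rwa [mul_sub, mul_div_cancel₀ _ h1.ne'] at h4

/-- The second order coefficient of `√(a + b t + c t²)` is nonpositive when `a + b t + c t²` is
the determinant of a pencil of `2 × 2` symmetric matrices based at a definite one. -/
lemma pencil_discrim_nonneg {g₁ g₂ g₃ h₁ h₂ h₃ : ℝ} (hg : 0 < g₁) (ha : 0 < g₁ * g₃ - g₂ * g₂) :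
    4 * (g₁ * g₃ - g₂ * g₂) * (h₁ * h₃ - h₂ * h₂) ≤
      (g₁ * h₃ + h₁ * g₃ - (g₂ * h₂ + h₂ * g₂)) ^ 2 := by
  -- Completing squares: g₁² times the discriminant is a square plus a square weighted by 4 det g >
  -- 0.
  have key : g₁ ^ 2 * ((g₁ * h₃ + h₁ * g₃ - (g₂ * h₂ + h₂ * g₂)) ^ 2 -
      4 * (g₁ * g₃ - g₂ * g₂) * (h₁ * h₃ - h₂ * h₂)) =
      (g₁ * (g₁ * h₃ - g₃ * h₁) - 2 * g₂ * (g₁ * h₂ - g₂ * h₁)) ^ 2 +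
        4 * (g₁ * g₃ - g₂ * g₂) * (g₁ * h₂ - g₂ * h₁) ^ 2 := by ring
  have h0 : 0 ≤ g₁ ^ 2 * ((g₁ * h₃ + h₁ * g₃ - (g₂ * h₂ + h₂ * g₂)) ^ 2 -
      4 * (g₁ * g₃ - g₂ * g₂) * (h₁ * h₃ - h₂ * h₂)) := by rw [key]; positivity
  have := nonneg_of_mul_nonneg_right h0 (by positivity)
  linarith

/-- With h₁ = 0 one has det h = −h₂². If h₂ ≠ 0 the left side is negative; if h₂ = 0 it is zero and
the right side is (g₁h₃)² > 0. The literal zeros match the goal obtained by rewriting the first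
entry of h. -/
lemma pencil_discrim_pos {g₁ g₂ g₃ h₂ h₃ : ℝ} (hg : 0 < g₁) (ha : 0 < g₁ * g₃ - g₂ * g₂)
    (h : h₃ ≠ 0) :
    4 * (g₁ * g₃ - g₂ * g₂) * (0 * h₃ - h₂ * h₂) <
      (g₁ * h₃ + 0 * g₃ - (g₂ * h₂ + h₂ * g₂)) ^ 2 := by
  rcases eq_or_ne h₂ 0 with rfl | h2
  · have : 0 < (g₁ * h₃) ^ 2 := by positivity
    simpa using this
  · have : 0 < (g₁ * g₃ - g₂ * g₂) * (h₂ * h₂) :=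
      mul_pos ha (mul_self_pos.2 h2)
    nlinarith [sq_nonneg (g₁ * h₃ + 0 * g₃ - (g₂ * h₂ + h₂ * g₂))]

end LinearAlgebra

/-! ### Continuity and comparison of tensors, openness of taming, test functions. -/

section Tensors

variable {m : ℕ} {M : Type*} [TopologicalSpace M] [ChartedSpace (E m) M]

variable [IsManifold (𝓡 m) ∞ M]

lemma endInChart_apply (J : AlmostComplexStructure m M) (c : M) {x : M} {y : E m}
    (hy : y ∈ (chart (m := m) c).target) (hxy : (chart (m := m) c).symm y = x)
    (w : TangentSpace (𝓡 m) x) :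
    (endInChart J c y (mfderiv (𝓡 m) (𝓡 m) (chart (m := m) c) x w) : E m) =
      mfderiv (𝓡 m) (𝓡 m) (chart (m := m) c) x (J x w) := by
  subst hxy
  change mfderiv (𝓡 m) (𝓡 m) (chart (m := m) c) _ (J _ (mfderiv (𝓡 m) (𝓡 m)
    (chart (m := m) c).symm y (mfderiv (𝓡 m) (𝓡 m) (chart (m := m) c) _ w))) = _
  rw [mfderiv_symm_mfderiv_chart c hy]

lemma DForm.apply_eq_inChart {k : ℕ} (σ : DForm m M k) (c : M) {x : M} {y : E m}
    (hy : y ∈ (chart (m := m) c).target) (hxy : (chart (m := m) c).symm y = x)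
    (v : Fin k → TangentSpace (𝓡 m) x) :
    σ x v = σ.inChart c y fun i => mfderiv (𝓡 m) (𝓡 m) (chart (m := m) c) x (v i) := by
  subst hxy
  refine congrArg (σ _) ?_
  funext i
  exact (mfderiv_symm_mfderiv_chart c hy (v i)).symm

lemma DForm.pair_eq_inChart (σ : DForm m M 2) (J : AlmostComplexStructure m M) (c : M) {x : M}
    {y : E m} (hy : y ∈ (chart (m := m) c).target) (hxy : (chart (m := m) c).symm y = x)
    (v w : TangentSpace (𝓡 m) x) :
    σ x ![v, J x w] = σ.inChart c y ![mfderiv (𝓡 m) (𝓡 m) (chart (m := m) c) x v,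
      endInChart J c y (mfderiv (𝓡 m) (𝓡 m) (chart (m := m) c) x w)] := by
  rw [σ.apply_eq_inChart c hy hxy, endInChart_apply J c hy hxy]
  congr 1
  funext i
  fin_cases i <;> rfl

omit [IsManifold (𝓡 m) ∞ M] in
lemma continuousOn_pair_inChart {σ : DForm m M 2} (hσ : σ.IsSmooth)
    (J : AlmostComplexStructure m M) (c : M) {X : Type*} [TopologicalSpace X] {s : Set X}
    {y v w : X → E m} (hy : ContinuousOn y s) (hys : MapsTo y s (chart (m := m) c).target)
    (hv : ContinuousOn v s) (hw : ContinuousOn w s) :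
    ContinuousOn (fun z => σ.inChart c (y z) ![v z, endInChart J c (y z) (w z)]) s := by
  refine ContinuousOn.eval ((hσ c).continuousOn.comp hy hys) (continuousOn_pi.2 fun i => ?_)
  fin_cases i
  · exact hv
  · exact ((J.smooth c).continuousOn.comp hy hys).clm_apply hw

/-- Continuity is local, and near a point it is read in the chart of M centred at its image, where
everything lives in ℝ^m. It is applied to F composed with an inverse chart of the surface. -/
lemma continuousOn_pair {k : ℕ} {σ : DForm m M 2} (hσ : σ.IsSmooth)
    (J : AlmostComplexStructure m M) {G : E k → M} {U : Set (E k)} (hU : IsOpen U)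
    (hG : ContMDiffOn (𝓡 k) (𝓡 m) ∞ G U) (e e' : E k) :
    ContinuousOn (fun z => σ (G z) ![mfderiv (𝓡 k) (𝓡 m) G z e,
      J (G z) (mfderiv (𝓡 k) (𝓡 m) G z e')]) U := by
  intro z₀ hz₀
  refine ContinuousAt.continuousWithinAt ?_
  set c : M := G z₀
  have hcs : IsOpen (chart (m := m) c).source := isOpen_extChartAt_source c
  have hGc : ContinuousOn G U := hG.continuousOn
  set W : Set (E k) := U ∩ G ⁻¹' (chart (m := m) c).source
  have hW : IsOpen W := hGc.isOpen_inter_preimage hU hcs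
  have hzW : z₀ ∈ W := ⟨hz₀, mem_extChartAt_source c⟩
  have hΦ : ContDiffOn ℝ ∞ (chart (m := m) c ∘ G) W := by
    refine contMDiffOn_iff_contDiffOn.1 ?_
    exact (contMDiffOn_extChartAt (I := 𝓡 m) (n := ∞) (x := c)).comp (hG.mono inter_subset_left)
      fun z hz => by simpa using hz.2
  have hD : ∀ a : E k, ContinuousOn (fun z => fderiv ℝ (chart (m := m) c ∘ G) z a) W := fun a =>
    (hΦ.continuousOn_fderiv_of_isOpen hW (by simp)).clm_apply continuousOn_const
  have hcont := continuousOn_pair_inChart hσ J c hΦ.continuousOn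
    (fun z hz => (chart (m := m) c).map_source hz.2) (hD e) (hD e')
  refine ContinuousOn.continuousAt (hcont.congr fun z hz => ?_) (hW.mem_nhds hzW)
  have hchain : ∀ a : E k, fderiv ℝ (chart (m := m) c ∘ G) z a =
      mfderiv (𝓡 m) (𝓡 m) (chart (m := m) c) (G z) (mfderiv (𝓡 k) (𝓡 m) G z a) := by
    intro a
    rw [← mfderiv_eq_fderiv, mfderiv_comp z (mdifferentiableAt_chart c hz.2)
      ((hG.contMDiffAt (hU.mem_nhds hz.1)).mdifferentiableAt (by simp))]
    rfl
  rw [σ.pair_eq_inChart J c ((chart (m := m) c).map_source hz.2)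
    ((chart (m := m) c).left_inv hz.2)]
  simp only [hchain]
  rfl

/-- Both sides are quadratic in v, so it suffices to bound their ratio on unit vectors. There it is
continuous on a compact set, with denominator positive by taming. -/
lemma DForm.pair_bound_nhds {σ η : DForm m M 2} (hσ : σ.IsSmooth) (hη : η.IsSmooth)
    (J : AlmostComplexStructure m M) (hJ : Tames σ J) (x₀ : M) :
    ∃ C : ℝ, ∀ᶠ x in 𝓝 x₀, ∀ v : TangentSpace (𝓡 m) x,
      |η x ![v, J x v]| ≤ C * σ x ![v, J x v] := by
  set T := (chart (m := m) x₀).target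
  have hT : IsOpen T := isOpen_extChartAt_target x₀
  have hx₀ : chart (m := m) x₀ x₀ ∈ T := mem_extChartAt_target x₀
  obtain ⟨r, hr, hrT⟩ := Metric.nhds_basis_closedBall.mem_iff.1 (hT.mem_nhds hx₀)
  have hpos : ∀ y ∈ T, ∀ u : E m, u ≠ 0 →
      0 < σ.inChart x₀ y ![u, endInChart J x₀ y u] := by
    intro y hy u hu
    have h := hJ ((chart (m := m) x₀).symm y)
      (mfderiv (𝓡 m) (𝓡 m) (chart (m := m) x₀).symm y u) (fun h0 => hu (by
        rw [← mfderiv_chart_mfderiv_symm x₀ hy u, h0]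
        exact map_zero _))
    rw [σ.pair_eq_inChart J x₀ hy rfl, mfderiv_chart_mfderiv_symm x₀ hy u] at h
    exact h
  set B := Metric.closedBall (chart (m := m) x₀ x₀) r ×ˢ Metric.sphere (0 : E m) 1
  have hB : IsCompact B := (isCompact_closedBall _ _).prod (isCompact_sphere _ _)
  have hcont : ∀ {θ : DForm m M 2}, θ.IsSmooth → ContinuousOn (fun p : E m × E m =>
      θ.inChart x₀ p.1 ![p.2, endInChart J x₀ p.1 p.2]) B := fun hθ =>
    continuousOn_pair_inChart hθ J x₀ continuousOn_fst (fun p hp => hrT hp.1)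
      continuousOn_snd continuousOn_snd
  have hne : ∀ p ∈ B, p.2 ≠ 0 := fun p hp h0 => by
    have := hp.2
    rw [h0] at this
    simp at this
  obtain ⟨C, hC⟩ := hB.exists_bound_of_continuousOn ((hcont hη).div (hcont hσ)
    fun p hp => (hpos p.1 (hrT hp.1) p.2 (hne p hp)).ne')
  refine ⟨C, ?_⟩
  have hxs : ∀ᶠ x in 𝓝 x₀, x ∈ (chart (m := m) x₀).source ∧
      chart (m := m) x₀ x ∈ Metric.closedBall (chart (m := m) x₀ x₀) r :=
    Filter.Eventually.and ((isOpen_extChartAt_source x₀).mem_nhds (mem_extChartAt_source x₀))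
      ((mdifferentiableAt_chart x₀ (mem_extChartAt_source x₀)).continuousAt.eventually
        (Metric.closedBall_mem_nhds _ hr))
  filter_upwards [hxs] with x hx v
  have hy := (chart (m := m) x₀).map_source hx.1
  rw [η.pair_eq_inChart J x₀ hy ((chart (m := m) x₀).left_inv hx.1),
    σ.pair_eq_inChart J x₀ hy ((chart (m := m) x₀).left_inv hx.1)]
  generalize (mfderiv (𝓡 m) (𝓡 m) (chart (m := m) x₀) x v : TangentSpace (𝓡 m) _) = u
  change E m at u
  change |η.inChart x₀ (chart (m := m) x₀ x) ![u, endInChart J x₀ (chart (m := m) x₀ x) u]| ≤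
    C * σ.inChart x₀ (chart (m := m) x₀ x) ![u, endInChart J x₀ (chart (m := m) x₀ x) u]
  rcases eq_or_ne u 0 with rfl | hu
  · have hz : ∀ θ : E m [⋀^Fin 2]→L[ℝ] ℝ, ∀ w : E m, θ ![0, w] = 0 := fun θ w => by
      simpa using alternating_smul_left θ 0 0 w
    rw [hz, hz]; simp
  · have hn : ‖u‖ ≠ 0 := norm_ne_zero_iff.2 hu
    -- Homogeneity: u is rescaled to the unit sphere and both sides pick up the factor ‖u‖².
    have hu' : u = ‖u‖ • (‖u‖⁻¹ • u) := by rw [smul_smul, mul_inv_cancel₀ hn, one_smul]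
    have hmem : (chart (m := m) x₀ x, ‖u‖⁻¹ • u) ∈ B :=
      ⟨hx.2, by simp [norm_smul, hn]⟩
    have h1 := hC _ hmem
    have h2 := hpos _ hy _ (hne _ hmem)
    simp only [Pi.div_apply] at h1
    rw [Real.norm_eq_abs, abs_div, abs_of_pos h2, div_le_iff₀ h2] at h1
    rw [hu', map_smul]
    simp only [alternating_smul_left, alternating_smul_right, abs_mul, abs_norm]
    calc _ = ‖u‖ * ‖u‖ * |η.inChart x₀ (chart (m := m) x₀ x) ![‖u‖⁻¹ • u,
            endInChart J x₀ (chart (m := m) x₀ x) (‖u‖⁻¹ • u)]| := by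
            simp only [map_smul, alternating_smul_left, alternating_smul_right, abs_mul]
            ring
      _ ≤ ‖u‖ * ‖u‖ * _ := mul_le_mul_of_nonneg_left h1 (by positivity)
      _ = _ := by
            simp only [map_smul, alternating_smul_left, alternating_smul_right]
            ring

/-- Local constants are glued by compactness; the maximum of two constants works because σ(v, Jv) ≥
0. -/
lemma DForm.pair_bound_compact {σ η : DForm m M 2} (hσ : σ.IsSmooth) (hη : η.IsSmooth)
    (J : AlmostComplexStructure m M) (hJ : Tames σ J) {K : Set M} (hK : IsCompact K) :
    ∃ C : ℝ, ∀ x ∈ K, ∀ v : TangentSpace (𝓡 m) x,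
      |η x ![v, J x v]| ≤ C * σ x ![v, J x v] := by
  have hnn : ∀ (x : M) (v : TangentSpace (𝓡 m) x), 0 ≤ σ x ![v, J x v] := fun x v => by
    rcases eq_or_ne v 0 with rfl | hv
    · simpa using (alternating_smul_left (σ x) 0 0 (J x 0)).ge
    · exact (hJ x v hv).le
  refine hK.induction_on (p := fun s => ∃ C : ℝ, ∀ x ∈ s, ∀ v : TangentSpace (𝓡 m) x,
      |η x ![v, J x v]| ≤ C * σ x ![v, J x v]) ⟨0, by simp⟩ ?_ ?_ ?_
  · rintro s t hst ⟨C, hC⟩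
    exact ⟨C, fun x hx => hC x (hst hx)⟩
  · rintro s t ⟨C, hC⟩ ⟨D, hD⟩
    refine ⟨max C D, fun x hx v => ?_⟩
    rcases hx with hx | hx
    · exact (hC x hx v).trans (mul_le_mul_of_nonneg_right (le_max_left _ _) (hnn x v))
    · exact (hD x hx v).trans (mul_le_mul_of_nonneg_right (le_max_right _ _) (hnn x v))
  · intro x _
    obtain ⟨C, hC⟩ := DForm.pair_bound_nhds hσ hη J hJ x
    exact ⟨_, mem_nhdsWithin_of_mem_nhds hC, C, fun y hy => hy⟩

/-- Adding a small multiple of a compactly supported function does not leave the space of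
potentials. -/
lemma exists_add_smul_mem_potentials {Ω : DForm m M 2} (hΩ : Ω.IsSmooth)
    (J : AlmostComplexStructure m M) {ρ f : M → ℝ} (hρ : ρ ∈ potentials Ω J)
    (hf : ContMDiff (𝓡 m) 𝓘(ℝ, ℝ) ∞ f) (hfc : HasCompactSupport f) :
    ∃ ε : ℝ, 0 < ε ∧ ∀ t ∈ Ioo (-ε) ε, (fun x => ρ x + t * f x) ∈ potentials Ω J := by
  obtain ⟨C, hC⟩ := DForm.pair_bound_compact (deform_isSmooth hΩ J hρ.1) (dc_isSmooth J hf).d J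
    hρ.2 hfc
  -- With this bound on |t| the perturbation is strictly smaller than Ω_ρ(v, Jv) on the support of
  -- f. The added 1 keeps the quotient defined when C = 0.
  refine ⟨1 / (|C| + 1), by positivity, fun t ht => ⟨hρ.1.add (contMDiff_const.mul hf), ?_⟩⟩
  intro x v hv
  have hpos := hρ.2 x v hv
  rw [deform_add_smul Ω J hρ.1 hf, ContinuousAlternatingMap.add_apply,
    ContinuousAlternatingMap.smul_apply, smul_eq_mul]
  by_cases hx : x ∈ tsupport f
  · have h1 := hC x hx v
    have ht' : |t| * (|C| + 1) < 1 := by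
      rw [← lt_div_iff₀ (by positivity)]; exact abs_lt.2 ht
    have h2 : |t * (dc J f).d x ![v, J x v]| < deform Ω J ρ x ![v, J x v] := by
      rw [abs_mul]
      calc |t| * |(dc J f).d x ![v, J x v]|
          ≤ |t| * ((|C| + 1) * deform Ω J ρ x ![v, J x v]) := by
            refine mul_le_mul_of_nonneg_left (h1.trans ?_) (abs_nonneg t)
            exact mul_le_mul_of_nonneg_right ((le_abs_self C).trans (by linarith)) hpos.le
        _ = |t| * (|C| + 1) * deform Ω J ρ x ![v, J x v] := by ring
        _ < 1 * deform Ω J ρ x ![v, J x v] := mul_lt_mul_of_pos_right ht' hpos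
        _ = _ := one_mul _
    have := (abs_lt.1 h2).1
    linarith
  · rw [d_dc_eq_zero J hf hx]
    simpa using hpos

/-- There is a compactly supported `f` with `dd^c f(v, Jv) = ℓ(v)² + ℓ(Jv)²` at a given point. -/
lemma exists_test_function [T2Space M] (J : AlmostComplexStructure m M) (x₀ : M)
    (l : E m →L[ℝ] ℝ) :
    ∃ f : M → ℝ, ContMDiff (𝓡 m) 𝓘(ℝ, ℝ) ∞ f ∧ HasCompactSupport f ∧
      ∀ v : TangentSpace (𝓡 m) x₀, (dc J f).d x₀ ![v, J x₀ v] = l v ^ 2 + l (J x₀ v) ^ 2 := by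
  let b : SmoothBumpFunction (𝓡 m) x₀ := Classical.arbitrary _
  set y₀ : E m := chart (m := m) x₀ x₀ with hy₀
  -- The differential of q vanishes at y₀, so derivatives of J do not enter dd^c q there and only
  -- the Hessian l ⊗ l survives.
  let q : E m → ℝ := fun y => (l (y - y₀)) ^ 2 / 2
  have hq : ContDiff ℝ ∞ q := ((l.contDiff.comp (contDiff_id.sub contDiff_const)).pow 2).div_const 2
  let f : M → ℝ := fun x => b x • q (chart (m := m) x₀ x)
  have hf : ContMDiff (𝓡 m) 𝓘(ℝ, ℝ) ∞ f :=
    b.contMDiff_smul (hq.contMDiff.comp_contMDiffOn contMDiffOn_extChartAt)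
  have hfc : HasCompactSupport f := b.hasCompactSupport.smul_right
  refine ⟨f, hf, hfc, fun v => ?_⟩
  have hx₀ : x₀ ∈ (chart (m := m) x₀).source := mem_extChartAt_source x₀
  have hyt : y₀ ∈ (chart (m := m) x₀).target := mem_extChartAt_target x₀
  have hsymm : (chart (m := m) x₀).symm y₀ = x₀ := (chart (m := m) x₀).left_inv hx₀
  have hev : ∀ᶠ y in 𝓝 y₀, y ∈ (chart (m := m) x₀).target ∧
      f ((chart (m := m) x₀).symm y) = q y := by
    have h1 : ∀ᶠ y in 𝓝 y₀, b ((chart (m := m) x₀).symm y) = 1 := by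
      refine (mdifferentiableAt_symm x₀ hyt).continuousAt.eventually (p := fun x => b x = 1) ?_
      rw [hsymm]
      exact b.eventuallyEq_one
    filter_upwards [h1, (isOpen_extChartAt_target x₀).mem_nhds hyt] with y hy hy'
    refine ⟨hy', ?_⟩
    simp only [f, hy, one_smul]
    rw [(chart (m := m) x₀).right_inv hy']
  have hfq : ∀ y, fderiv ℝ q y = l (y - y₀) • l := by
    intro y
    have h1 : HasFDerivAt (fun y => l (y - y₀)) l y :=
      l.hasFDerivAt.comp y ((hasFDerivAt_id y).sub_const y₀)
    have h2 := ((h1.pow 2).mul_const (2⁻¹ : ℝ)).fderiv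
    ext w
    have h3 : q = fun y => l (y - y₀) ^ 2 * 2⁻¹ := by funext y; simp only [q]; ring
    rw [h3, h2]
    simp only [nsmul_eq_mul, smul_apply, smul_eq_mul]
    norm_num
    ring
  have hα : (dc J f).inChart x₀ =ᶠ[𝓝 y₀] fun y =>
      ContinuousAlternatingMap.ofSubsingletonLIE (𝕜 := ℝ) (0 : Fin 1)
        (-(l (y - y₀) • l.comp (endInChart J x₀ y))) := by
    filter_upwards [hev.eventually_nhds] with y hy
    have h1 : f ∘ (chart (m := m) x₀).symm =ᶠ[𝓝 y] q := hy.mono fun z hz => hz.2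
    rw [dc_inChart J hf x₀ hy.self_of_nhds.1, h1.fderiv_eq, hfq, ContinuousLinearMap.smul_comp]
  have hA : DifferentiableAt ℝ (endInChart J x₀) y₀ :=
    ((J.smooth x₀).contDiffAt ((isOpen_extChartAt_target x₀).mem_nhds hyt)).differentiableAt
      (by simp)
  have hαd : DifferentiableAt ℝ ((dc J f).inChart x₀) y₀ :=
    ((dc_isSmooth J hf x₀).contDiffAt ((isOpen_extChartAt_target x₀).mem_nhds hyt)).differentiableAt
      (by simp)
  have hpart : ∀ u w : E m, ∀ z : Fin 1 → E m, z 0 = w →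
      fderiv ℝ (fun y => (dc J f).inChart x₀ y z) y₀ u =
      -(l u * l (endInChart J x₀ y₀ w)) := by
    intro u w z hz
    have h1 : (fun y => (dc J f).inChart x₀ y z) =ᶠ[𝓝 y₀]
        fun y => -(l (y - y₀) * l (endInChart J x₀ y w)) := by
      filter_upwards [hα] with y hy
      rw [hy, ← hz]
      rfl
    have h2 : HasFDerivAt (fun y => l (y - y₀)) l y₀ :=
      l.hasFDerivAt.comp y₀ ((hasFDerivAt_id y₀).sub_const y₀)
    have h3 : DifferentiableAt ℝ (fun y => l (endInChart J x₀ y w)) y₀ :=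
      l.differentiableAt.comp y₀ (hA.clm_apply (differentiableAt_const w))
    have h4 : HasFDerivAt (fun y => -(l (y - y₀) * l (endInChart J x₀ y w))) _ y₀ :=
      (h2.mul h3.hasFDerivAt).neg
    rw [h1.fderiv_eq, h4.fderiv]
    simp [mul_comm]
  have hext : ∀ u w : E m, extDeriv ((dc J f).inChart x₀) y₀ ![u, w] =
      -(l u * l (endInChart J x₀ y₀ w)) + l w * l (endInChart J x₀ y₀ u) := by
    intro u w
    rw [extDeriv_apply hαd, Fin.sum_univ_two, hpart _ w _ rfl, hpart _ u _ rfl]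
    simp
  -- The chart centred at x₀ has identity derivative at x₀, so l acts on the tangent space there
  -- without conversion.
  have hD : ∀ w : TangentSpace (𝓡 m) x₀,
      mfderiv (𝓡 m) (𝓡 m) (chart (m := m) x₀) x₀ w = w := fun w => by
    rw [mfderiv_extChartAt_self]; rfl
  have hA₀ : ∀ w : TangentSpace (𝓡 m) x₀, endInChart J x₀ y₀ w = J x₀ w := fun w => by
    have h := endInChart_apply J x₀ hyt hsymm w
    rwa [hD w, hD] at h
  rw [DForm.apply_eq_inChart _ x₀ hyt hsymm, DForm.d_inChart (dc_isSmooth J hf) x₀ hyt]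
  have hvec : (fun i => mfderiv (𝓡 m) (𝓡 m) (chart (m := m) x₀) x₀ (![v, J x₀ v] i)) =
      ![v, J x₀ v] := by
    funext i
    fin_cases i <;> exact hD _
  refine (congrArg _ hvec).trans ((hext v (J x₀ v)).trans ?_)
  -- J² = −1 turns −l(v) l(JJv) into l(v)², the first square of the claim.
  have e2 : endInChart J x₀ y₀ (J x₀ v) = -v := (hA₀ _).trans (J.sq x₀ v)
  have e1 : endInChart J x₀ y₀ v = J x₀ v := hA₀ v
  have e3 : l (-v : E m) = -l v := map_neg l v
  rw [e1]
  refine (congrArg (fun z => -(l v * l z) + l (J x₀ v) * l (J x₀ v)) e2).trans ?_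
  refine (congrArg (fun z => -(l v * z) + l (J x₀ v) * l (J x₀ v)) e3).trans ?_
  ring

end Tensors

/-! ### Differentiating integrals of √(a + bt + ct²) twice under the integral sign. -/

section Analysis

/-- `Φ` is differentiable near `0` and its derivative has derivative `D` at `0`. -/
def HasSecondDerivAtZero (Φ : ℝ → ℝ) (D : ℝ) : Prop :=
  ∃ Φ' : ℝ → ℝ, (∀ᶠ t in 𝓝 0, HasDerivAt Φ (Φ' t) t) ∧ HasDerivAt Φ' D 0

lemma HasSecondDerivAtZero.iteratedDeriv_eq {Φ : ℝ → ℝ} {D : ℝ} (h : HasSecondDerivAtZero Φ D) :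
    iteratedDeriv 2 Φ 0 = D := by
  obtain ⟨Φ', h1, h2⟩ := h
  rw [iteratedDeriv_succ, iteratedDeriv_one]
  have h3 : deriv Φ =ᶠ[𝓝 0] Φ' := h1.mono fun t ht => ht.deriv
  rw [h3.deriv_eq, h2.deriv]

lemma HasSecondDerivAtZero.sum {ι : Type*} (s : Finset ι) {Φ : ι → ℝ → ℝ} {D : ι → ℝ}
    (h : ∀ i ∈ s, HasSecondDerivAtZero (Φ i) (D i)) :
    HasSecondDerivAtZero (fun t => ∑ i ∈ s, Φ i t) (∑ i ∈ s, D i) := by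
  choose! Φ' h1 h2 using h
  refine ⟨fun t => ∑ i ∈ s, Φ' i t, ?_, HasDerivAt.fun_sum h2⟩
  have h3 : ∀ᶠ t in 𝓝 (0 : ℝ), ∀ i ∈ s, HasDerivAt (Φ i) (Φ' i t) t :=
    (Finset.eventually_all s).2 h1
  exact h3.mono fun t ht => HasDerivAt.fun_sum ht

lemma HasSecondDerivAtZero.congr {Φ Ψ : ℝ → ℝ} {D : ℝ} (h : HasSecondDerivAtZero Φ D)
    (hΨ : Ψ =ᶠ[𝓝 0] Φ) : HasSecondDerivAtZero Ψ D := by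
  obtain ⟨Φ', h1, h2⟩ := h
  refine ⟨Φ', ?_, h2⟩
  filter_upwards [h1, hΨ.eventually_nhds] with t ht ht'
  exact ht.congr_of_eventuallyEq ht'

variable {X : Type*} [TopologicalSpace X] [T2Space X] [MeasurableSpace X] [BorelSpace X]
  {μ : Measure X} [IsFiniteMeasureOnCompacts μ]

lemma hasDerivAt_setIntegral_of_isCompact {Q : Set X} (hQ : IsCompact Q) {G G' : ℝ → X → ℝ}
    {ε : ℝ} (hG : ∀ t ∈ Icc (-ε) ε, ContinuousOn (G t) Q)
    (hG' : ContinuousOn (fun p : ℝ × X => G' p.1 p.2) (Icc (-ε) ε ×ˢ Q))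
    (hd : ∀ t ∈ Icc (-ε) ε, ∀ y ∈ Q, HasDerivAt (fun t => G t y) (G' t y) t)
    {t₀ : ℝ} (ht₀ : t₀ ∈ Ioo (-ε) ε) :
    HasDerivAt (fun t => ∫ y in Q, G t y ∂μ) (∫ y in Q, G' t₀ y ∂μ) t₀ := by
  have hQm : MeasurableSet Q := hQ.measurableSet
  obtain ⟨C, hC⟩ := (isCompact_Icc.prod hQ).exists_bound_of_continuousOn hG'
  have hs : Ioo (-ε) ε ∈ 𝓝 t₀ := isOpen_Ioo.mem_nhds ht₀
  have hint : IntegrableOn (G t₀) Q μ := (hG t₀ (Ioo_subset_Icc_self ht₀)).integrableOn_compact hQ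
  have hG't : ContinuousOn (G' t₀) Q := hG'.comp (f := fun y => (t₀, y)) (by fun_prop)
    fun y hy => ⟨Ioo_subset_Icc_self ht₀, hy⟩
  refine (hasDerivAt_integral_of_dominated_loc_of_deriv_le (μ := μ.restrict Q) (F := G)
    (F' := G') (bound := fun _ => C) hs ?_ hint (hG't.integrableOn_compact hQ).1 ?_ ?_ ?_).2
  · filter_upwards [hs] with t ht
    exact ((hG t (Ioo_subset_Icc_self ht)).integrableOn_compact hQ).1
  · filter_upwards [ae_restrict_mem hQm] with y hy t ht
    exact hC (t, y) ⟨Ioo_subset_Icc_self ht, hy⟩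
  · exact integrableOn_const hQ.measure_lt_top.ne
  · filter_upwards [ae_restrict_mem hQm] with y hy t ht
    exact hd t (Ioo_subset_Icc_self ht) y hy

omit [T2Space X] [MeasurableSpace X] [BorelSpace X] in
-- Differentiation under the integral needs a positive radicand on one interval of times valid for
-- all of Q; compactness bounds (|b| + |c|)/a and provides it.
lemma exists_quadratic_pos {Q : Set X} (hQ : IsCompact Q) {a b c : X → ℝ}
    (ha : ContinuousOn a Q) (hb : ContinuousOn b Q) (hc : ContinuousOn c Q)
    (hpos : ∀ y ∈ Q, 0 < a y) :
    ∃ ε : ℝ, 0 < ε ∧ ∀ t ∈ Icc (-ε) ε, ∀ y ∈ Q, 0 < a y + b y * t + c y * t ^ 2 := by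
  obtain ⟨C, hC⟩ := hQ.exists_bound_of_continuousOn
    ((hb.abs.add hc.abs).div ha fun y hy => (hpos y hy).ne')
  refine ⟨1 / (|C| + 1), by positivity, fun t ht y hy => ?_⟩
  have h1 := hC y hy
  have hay := hpos y hy
  simp only [Pi.div_apply, Pi.add_apply] at h1
  rw [Real.norm_eq_abs, abs_div, abs_of_pos hay, div_le_iff₀ hay, abs_of_nonneg (by positivity)]
    at h1
  -- The added 1 also forces |t| ≤ 1, so t² ≤ |t| and both coefficients are controlled by |t|.
  have ht1 : |t| * (|C| + 1) ≤ 1 := by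
    rw [← le_div_iff₀ (by positivity)]; exact abs_le.2 ht
  have ht2 : |t| ≤ 1 := by nlinarith [abs_nonneg t, abs_nonneg C]
  have h2 : |b y * t + c y * t ^ 2| ≤ (|b y| + |c y|) * |t| := by
    refine (abs_add_le _ _).trans ?_
    rw [abs_mul, abs_mul, abs_pow, add_mul]
    have : |c y| * |t| ^ 2 ≤ |c y| * |t| :=
      mul_le_mul_of_nonneg_left (by nlinarith [abs_nonneg t]) (abs_nonneg _)
    linarith
  have h3 : (|b y| + |c y|) * |t| < a y := by
    have h4 : (|b y| + |c y|) * |t| ≤ (|C| * a y) * |t| :=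
      mul_le_mul_of_nonneg_right
        (h1.trans (mul_le_mul_of_nonneg_right (le_abs_self C) hay.le)) (abs_nonneg t)
    rcases eq_or_ne t 0 with rfl | h0
    · simpa using hay
    · have h5 : 0 < |t| := abs_pos.2 h0
      have h6 : |C| * |t| < 1 := by nlinarith
      nlinarith
  have := (abs_le.1 h2).1
  linarith

lemma hasDerivAt_sqrt_quadratic {a b c t : ℝ} (h : 0 < a + b * t + c * t ^ 2) :
    HasDerivAt (fun t => √(a + b * t + c * t ^ 2))
      ((b + 2 * c * t) / (2 * √(a + b * t + c * t ^ 2))) t := by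
  have h1 : HasDerivAt (fun t => a + b * t + c * t ^ 2) (b + 2 * c * t) t := by
    have h2 := (((hasDerivAt_id t).const_mul b).const_add a).add ((hasDerivAt_pow 2 t).const_mul c)
    refine h2.congr_deriv ?_
    simp; ring
  exact h1.sqrt h.ne'

lemma hasDerivAt_deriv_sqrt_quadratic {a b c t : ℝ} (h : 0 < a + b * t + c * t ^ 2) :
    HasDerivAt (fun t => (b + 2 * c * t) / (2 * √(a + b * t + c * t ^ 2)))
      ((2 * c * (2 * √(a + b * t + c * t ^ 2)) - (b + 2 * c * t) *
        (2 * ((b + 2 * c * t) / (2 * √(a + b * t + c * t ^ 2))))) /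
        (2 * √(a + b * t + c * t ^ 2)) ^ 2) t := by
  have h1 : HasDerivAt (fun t => b + 2 * c * t) (2 * c) t := by
    simpa using ((hasDerivAt_id t).const_mul (2 * c)).const_add b
  exact h1.div ((hasDerivAt_sqrt_quadratic h).const_mul 2)
    (mul_pos two_pos (Real.sqrt_pos.2 h)).ne'

/-- On a compact time interval times Q the first two t-derivatives of the integrand are continuous,
hence bounded, and dominated convergence applies twice. The power a^{3/2} appears as a√a. -/
lemma hasSecondDerivAtZero_integral_sqrt {Q : Set X} (hQ : IsCompact Q) {w a b c : X → ℝ}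
    (hw : ContinuousOn w Q) (ha : ContinuousOn a Q) (hb : ContinuousOn b Q)
    (hc : ContinuousOn c Q) (hpos : ∀ y ∈ Q, 0 < a y) :
    HasSecondDerivAtZero (fun t => ∫ y in Q, w y * √(a y + b y * t + c y * t ^ 2) ∂μ)
      (∫ y in Q, w y * ((4 * a y * c y - b y ^ 2) / (4 * (a y * √(a y)))) ∂μ) := by
  obtain ⟨ε, hε, hP⟩ := exists_quadratic_pos hQ ha hb hc hpos
  set B := Icc (-ε) ε ×ˢ Q
  have hlift : ∀ {u : X → ℝ}, ContinuousOn u Q → ContinuousOn (fun p : ℝ × X => u p.2) B :=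
    fun hu => hu.comp continuousOn_snd fun p hp => hp.2
  have ht : ContinuousOn (fun p : ℝ × X => p.1) B := continuousOn_fst
  have hS : ContinuousOn (fun p : ℝ × X => √(a p.2 + b p.2 * p.1 + c p.2 * p.1 ^ 2)) B :=
    (((hlift ha).add ((hlift hb).mul ht)).add ((hlift hc).mul (ht.pow 2))).sqrt
  have hS0 : ∀ p ∈ B, 2 * √(a p.2 + b p.2 * p.1 + c p.2 * p.1 ^ 2) ≠ 0 := fun p hp =>
    (mul_pos two_pos (Real.sqrt_pos.2 (hP p.1 hp.1 p.2 hp.2))).ne'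
  have hN : ContinuousOn (fun p : ℝ × X => b p.2 + 2 * c p.2 * p.1) B :=
    (hlift hb).add ((continuousOn_const.mul (hlift hc)).mul ht)
  have hD1 : ContinuousOn (fun p : ℝ × X => w p.2 * ((b p.2 + 2 * c p.2 * p.1) /
      (2 * √(a p.2 + b p.2 * p.1 + c p.2 * p.1 ^ 2)))) B :=
    (hlift hw).mul (hN.div (continuousOn_const.mul hS) hS0)
  have hD2 : ContinuousOn (fun p : ℝ × X => w p.2 *
      ((2 * c p.2 * (2 * √(a p.2 + b p.2 * p.1 + c p.2 * p.1 ^ 2)) - (b p.2 + 2 * c p.2 * p.1) *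
        (2 * ((b p.2 + 2 * c p.2 * p.1) / (2 * √(a p.2 + b p.2 * p.1 + c p.2 * p.1 ^ 2))))) /
        (2 * √(a p.2 + b p.2 * p.1 + c p.2 * p.1 ^ 2)) ^ 2)) B := by
    refine (hlift hw).mul (ContinuousOn.div (ContinuousOn.sub ?_ ?_)
      ((continuousOn_const.mul hS).pow 2) fun p hp => pow_ne_zero 2 (hS0 p hp))
    · exact (continuousOn_const.mul (hlift hc)).mul (continuousOn_const.mul hS)
    · exact hN.mul (continuousOn_const.mul (hN.div (continuousOn_const.mul hS) hS0))
  have hslice : ∀ {u : ℝ × X → ℝ}, ContinuousOn u B → ∀ t ∈ Icc (-ε) ε,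
      ContinuousOn (fun y => u (t, y)) Q := fun hu t htε =>
    hu.comp (f := fun y => (t, y)) (by fun_prop) fun y hy => ⟨htε, hy⟩
  refine ⟨fun t => ∫ y in Q, w y * ((b y + 2 * c y * t) /
    (2 * √(a y + b y * t + c y * t ^ 2))) ∂μ, ?_, ?_⟩
  · filter_upwards [Ioo_mem_nhds (neg_lt_zero.2 hε) hε] with t htε
    exact hasDerivAt_setIntegral_of_isCompact hQ (hslice ((hlift hw).mul hS)) hD1
      (fun t ht y hy => (hasDerivAt_sqrt_quadratic (hP t ht y hy)).const_mul (w y)) htε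
  · have h := hasDerivAt_setIntegral_of_isCompact (μ := μ) hQ (hslice hD1) hD2
      (fun t ht y hy => (hasDerivAt_deriv_sqrt_quadratic (hP t ht y hy)).const_mul (w y))
      (t₀ := 0) ⟨neg_lt_zero.2 hε, hε⟩
    refine h.congr_deriv (setIntegral_congr_fun hQ.measurableSet fun y hy => ?_)
    have hs : 0 < √(a y) := Real.sqrt_pos.2 (hpos y hy)
    have hsq : √(a y) ^ 2 = a y := Real.sq_sqrt (hpos y hy).le
    simp only [mul_zero, add_zero, ne_eq, OfNat.ofNat_ne_zero, not_false_eq_true, zero_pow]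
    congr 1
    rw [← sub_eq_zero]
    have ha0 := (hpos y hy).ne'
    field_simp
    rw [hsq]
    ring

end Analysis

/-! ### The area of a compact region and the Gram matrix of the immersion. -/

section Area

variable {S : Type*} [TopologicalSpace S] [T2Space S] [SigmaCompactSpace S]
  [ChartedSpace (E 2) S] [IsManifold (𝓡 2) ∞ S]

/-- The image in the chart centred at `c` of the part of `K` that carries the `c`-th function of
the partition of unity. -/
def chartPiece (K : Set S) (c : S) : Set (E 2) :=
  chart (m := 2) c '' (K ∩ tsupport (chartPartition S c))

lemma tsupport_chartPartition_subset (c : S) :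
    tsupport (chartPartition S c) ⊆ (chart (m := 2) c).source := by
  have h := (SmoothPartitionOfUnity.exists_isSubordinate_chartAt_source (𝓡 2) S).choose_spec c
  rw [extChartAt_source]
  exact h

lemma mem_chartPiece {K : Set S} {c : S} {y : E 2} (hy : y ∈ (chart (m := 2) c).target) :
    y ∈ chartPiece K c ↔ (chart (m := 2) c).symm y ∈ K ∩ tsupport (chartPartition S c) := by
  constructor
  · rintro ⟨x, hx, rfl⟩
    rwa [(chart (m := 2) c).left_inv (tsupport_chartPartition_subset c hx.2)]
  · intro h
    exact ⟨_, h, (chart (m := 2) c).right_inv hy⟩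

lemma chartPiece_subset (K : Set S) (c : S) :
    chartPiece K c ⊆ (chart (m := 2) c).target ∩ (chart (m := 2) c).symm ⁻¹' K := by
  rintro _ ⟨x, hx, rfl⟩
  have hxs := tsupport_chartPartition_subset c hx.2
  refine ⟨(chart (m := 2) c).map_source hxs, ?_⟩
  rw [mem_preimage, (chart (m := 2) c).left_inv hxs]
  exact hx.1

lemma isCompact_chartPiece {K : Set S} (hK : IsCompact K) (c : S) :
    IsCompact (chartPiece K c) :=
  (hK.inter_right (isClosed_tsupport _)).image_of_continuousOn
    ((continuousOn_extChartAt c).mono fun _ hx => tsupport_chartPartition_subset c hx.2)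

lemma continuousOn_chartPartition (c c' : S) :
    ContinuousOn (fun y => chartPartition S c ((chart (m := 2) c').symm y))
      (chart (m := 2) c').target :=
  (chartPartition S c).contMDiff.continuous.comp_continuousOn (continuousOn_extChartAt_symm c')

lemma finite_chartPiece_nonempty {K : Set S} (hK : IsCompact K) :
    {c : S | (chartPiece K c).Nonempty}.Finite := by
  refine ((chartPartition S).locallyFinite.closure.finite_nonempty_inter_compact hK).subset ?_
  rintro c ⟨_, x, hx, _⟩
  exact ⟨x, hx.2, hx.1⟩

/-- The part of a chart target over K need not be compact, but the partition function vanishes off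
its support, so the integral lives on the compact set `chartPiece K c`. -/
lemma lintegral_chart_eq {K : Set S} (hK : IsCompact K) (c : S) (u : E 2 → ℝ) :
    ∫⁻ y in (chart (m := 2) c).target ∩ (chart c).symm ⁻¹' K,
      ENNReal.ofReal (chartPartition S c ((chart c).symm y) * u y) =
    ∫⁻ y in chartPiece K c, ENNReal.ofReal (chartPartition S c ((chart c).symm y) * u y) := by
  set T := (chart (m := 2) c).target
  have hT : IsOpen T := isOpen_extChartAt_target c
  have hQ : MeasurableSet (chartPiece K c) := (isCompact_chartPiece hK c).measurableSet
  have hA : MeasurableSet (T ∩ (chart (m := 2) c).symm ⁻¹' K) := by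
    have h1 : IsOpen (T ∩ (chart (m := 2) c).symm ⁻¹' Kᶜ) :=
      (continuousOn_extChartAt_symm c).isOpen_inter_preimage hT hK.isClosed.isOpen_compl
    have h2 : T ∩ (chart (m := 2) c).symm ⁻¹' K = T \ (T ∩ (chart (m := 2) c).symm ⁻¹' Kᶜ) := by
      ext y; simp +contextual
    rw [h2]
    exact hT.measurableSet.diff h1.measurableSet
  rw [← lintegral_inter_add_sdiff _ _ hQ, inter_eq_right.2 (chartPiece_subset K c),
    setLIntegral_eq_zero (hA.diff hQ), add_zero]
  rintro y ⟨⟨hyT, hyK⟩, hyQ⟩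
  have h0 : (chart (m := 2) c).symm y ∉ tsupport (chartPartition S c) := fun h =>
    hyQ ((mem_chartPiece hyT).2 ⟨hyK, h⟩)
  simp only [image_eq_zero_of_notMem_tsupport h0, zero_mul, ENNReal.ofReal_zero, Pi.zero_apply]

/-- The area of a compact region is a finite sum of integrals of continuous functions over
compact sets. -/
lemma toReal_area {g : (p : S) → TangentSpace (𝓡 2) p → TangentSpace (𝓡 2) p → ℝ}
    {K : Set S} (hK : IsCompact K)
    (hg : ∀ c : S, ContinuousOn (areaDensity g c) (chart (m := 2) c).target) :
    (area g K).toReal = ∑ c ∈ (finite_chartPiece_nonempty hK).toFinset,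
      ∫ y in chartPiece K c, chartPartition S c ((chart c).symm y) * areaDensity g c y := by
  have hQ : ∀ c, MeasurableSet (chartPiece K c) := fun c =>
    (isCompact_chartPiece hK c).measurableSet
  have hint : ∀ c, IntegrableOn (fun y => chartPartition S c ((chart (m := 2) c).symm y) *
      areaDensity g c y) (chartPiece K c) := fun c =>
    (((continuousOn_chartPartition c c).mul (hg c)).mono fun y hy =>
      (chartPiece_subset K c hy).1).integrableOn_compact (isCompact_chartPiece hK c)
  have hnn : ∀ c y, 0 ≤ chartPartition S c ((chart (m := 2) c).symm y) * areaDensity g c y :=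
    fun c y => mul_nonneg ((chartPartition S).nonneg c _) (Real.sqrt_nonneg _)
  unfold area
  simp only [lintegral_chart_eq hK]
  rw [tsum_eq_sum (s := (finite_chartPiece_nonempty hK).toFinset), ENNReal.toReal_sum]
  · refine Finset.sum_congr rfl fun c _ => ?_
    rw [← ofReal_integral_eq_lintegral_ofReal (hint c) (Eventually.of_forall (hnn c)),
      ENNReal.toReal_ofReal (integral_nonneg (hnn c))]
  · intro c _
    rw [← ofReal_integral_eq_lintegral_ofReal (hint c) (Eventually.of_forall (hnn c))]
    exact ENNReal.ofReal_ne_top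
  · intro c hc
    have : chartPiece K c = ∅ := by
      rw [← not_nonempty_iff_eq_empty]
      simpa using hc
    rw [this]; simp

variable {m : ℕ} {M : Type*} [TopologicalSpace M] [ChartedSpace (E m) M] [IsManifold (𝓡 m) ∞ M]

/-- The coordinate tangent vectors of the surface in the chart centred at `c`, pushed forward
to `M`. -/
def frame (F : S → M) (c : S) (y : E 2) (i : Fin 2) :
    TangentSpace (𝓡 m) (F ((chart (m := 2) c).symm y)) :=
  mfderiv (𝓡 2) (𝓡 m) F ((chart (m := 2) c).symm y)
    (mfderiv (𝓡 2) (𝓡 2) (chart c).symm y (EuclideanSpace.single i (1 : ℝ)))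

/-- The coefficients of the pulled back tensor in the chart centred at `c`. -/
def gram (σ : DForm m M 2) (J : AlmostComplexStructure m M) (F : S → M) (c : S) (y : E 2)
    (i j : Fin 2) : ℝ :=
  symForm (σ (F ((chart (m := 2) c).symm y))) (J (F ((chart (m := 2) c).symm y)))
    (frame F c y i) (frame F c y j)

omit [T2Space S] [SigmaCompactSpace S] [IsManifold (𝓡 2) ∞ S] [IsManifold (𝓡 m) ∞ M] in
lemma areaDensity_eq_gram (σ : DForm m M 2) (J : AlmostComplexStructure m M) (F : S → M) (c : S)
    (y : E 2) : areaDensity (pullbackMetric F (metric σ J)) c y =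
      √(gram σ J F c y 0 0 * gram σ J F c y 1 1 - gram σ J F c y 0 1 * gram σ J F c y 1 0) := by
  unfold areaDensity
  rw [Matrix.det_fin_two]
  rfl

omit [T2Space S] [SigmaCompactSpace S] [IsManifold (𝓡 2) ∞ S] [IsManifold (𝓡 m) ∞ M] in
lemma gram_comm (σ : DForm m M 2) (J : AlmostComplexStructure m M) (F : S → M) (c : S) (y : E 2)
    (i j : Fin 2) : gram σ J F c y i j = gram σ J F c y j i := symForm_comm _ _ _ _

omit [T2Space S] [SigmaCompactSpace S] in
lemma continuousOn_gram {σ : DForm m M 2} (hσ : σ.IsSmooth) (J : AlmostComplexStructure m M)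
    {F : S → M} (hF : ContMDiff (𝓡 2) (𝓡 m) ∞ F) (c : S) (i j : Fin 2) :
    ContinuousOn (fun y => gram σ J F c y i j) (chart (m := 2) c).target := by
  have hG : ContMDiffOn (𝓡 2) (𝓡 m) ∞ (F ∘ (chart (m := 2) c).symm) (chart (m := 2) c).target :=
    hF.comp_contMDiffOn (contMDiffOn_extChartAt_symm c)
  have h := fun a b => continuousOn_pair hσ J (isOpen_extChartAt_target c) hG
    (EuclideanSpace.single a (1 : ℝ)) (EuclideanSpace.single b (1 : ℝ))
  refine (((h i j).add (h j i)).div_const 2).congr fun y hy => ?_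
  have hchain : ∀ a, mfderiv (𝓡 2) (𝓡 m) (F ∘ (chart (m := 2) c).symm) y
      (EuclideanSpace.single a (1 : ℝ)) = frame F c y a := by
    intro a
    rw [mfderiv_comp y (hF.mdifferentiableAt (by simp)) (mdifferentiableAt_symm c hy)]
    rfl
  exact congrArg₂ (fun v w : TangentSpace (𝓡 m) (F ((chart (m := 2) c).symm y)) =>
    (σ _ ![v, J _ w] + σ _ ![w, J _ v]) / 2) (hchain i).symm (hchain j).symm

omit [T2Space S] [SigmaCompactSpace S] [IsManifold (𝓡 m) ∞ M] in
-- A composite of two injective derivatives, of the inverse chart and of the immersion, is injective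
-- on ℝ².
lemma frame_independent {F : S → M} (hF : IsSmoothImmersion (m := m) F) {c : S} {y : E 2}
    (hy : y ∈ (chart (m := 2) c).target) {a b : ℝ}
    (h : a • frame (m := m) F c y 0 + b • frame F c y 1 = 0) : a = 0 ∧ b = 0 := by
  let D : E 2 →L[ℝ] E m := ContinuousLinearMap.comp
    (mfderiv (𝓡 2) (𝓡 m) F ((chart (m := 2) c).symm y))
    (mfderiv (𝓡 2) (𝓡 2) (chart (m := 2) c).symm y)
  set u : E 2 := a • EuclideanSpace.single 0 (1 : ℝ) + b • EuclideanSpace.single 1 (1 : ℝ) with hu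
  have hDu : D u = 0 := by
    rw [hu, map_add, map_smul, map_smul]
    exact h
  have h1 : mfderiv (𝓡 2) (𝓡 2) (chart (m := 2) c).symm y u = 0 :=
    hF.2 _ (hDu.trans (map_zero _).symm)
  have h2 : u = 0 := by
    rw [← mfderiv_chart_mfderiv_symm c hy u, h1]
    exact map_zero _
  constructor
  · simpa [hu] using congrArg (fun v : E 2 => v 0) h2
  · simpa [hu] using congrArg (fun v : E 2 => v 1) h2

omit [T2Space S] [SigmaCompactSpace S] [IsManifold (𝓡 m) ∞ M] in
lemma gram_det_pos_of_tames {σ : DForm m M 2} {J : AlmostComplexStructure m M}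
    (hσ : Tames σ J) {F : S → M} (hF : IsSmoothImmersion (m := m) F) {c : S} {y : E 2}
    (hy : y ∈ (chart (m := 2) c).target) :
    0 < gram σ J F c y 0 0 ∧
    0 < gram σ J F c y 0 0 * gram σ J F c y 1 1 - gram σ J F c y 0 1 * gram σ J F c y 1 0 := by
  have hX : frame (m := m) F c y 0 ≠ 0 := fun h => by
    have := frame_independent hF hy (a := 1) (b := 0) (by rw [h]; simp)
    simp at this
  have hpos : ∀ v, v ≠ 0 → 0 < symForm (σ (F ((chart (m := 2) c).symm y)))
      (J (F ((chart (m := 2) c).symm y))) v v := fun v hv => by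
    rw [symForm_self]; exact hσ _ v hv
  refine ⟨hpos _ hX, gram_det_pos _ (symForm_comm _ _) hpos hX fun a h => ?_⟩
  have := frame_independent hF hy (a := -a) (b := 1) (by rw [h]; simp)
  simp at this

end Area

/-! ### Sign of the second variation and the contradiction with stability. -/

section Stability

variable {m : ℕ} {M : Type*} [TopologicalSpace M] [ChartedSpace (E m) M] [IsManifold (𝓡 m) ∞ M]
  {S : Type*} [TopologicalSpace S] [T2Space S] [SigmaCompactSpace S]
  [ChartedSpace (E 2) S] [IsManifold (𝓡 2) ∞ S]

/-- The second derivative at `t = 0` of the area density of `G + t H`, weighted by the partition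
of unity, where `G` and `H` are the pullbacks of the tensors of `σ` and `η`. -/
def secondDensity (σ η : DForm m M 2) (J : AlmostComplexStructure m M) (F : S → M) (c : S)
    (y : E 2) : ℝ :=
  let g := gram σ J F c y
  let h := gram η J F c y
  let a := g 0 0 * g 1 1 - g 0 1 * g 0 1
  chartPartition S c ((chart (m := 2) c).symm y) *
    ((4 * a * (h 0 0 * h 1 1 - h 0 1 * h 0 1) -
      (g 0 0 * h 1 1 + h 0 0 * g 1 1 - (g 0 1 * h 0 1 + h 0 1 * g 0 1)) ^ 2) / (4 * (a * √a)))

lemma continuousOn_secondDensity {σ η : DForm m M 2} (hσ : σ.IsSmooth) (hη : η.IsSmooth)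
    {J : AlmostComplexStructure m M} (hJ : Tames σ J) {F : S → M}
    (hF : IsSmoothImmersion (m := m) F) (c : S) :
    ContinuousOn (secondDensity σ η J F c) (chart (m := 2) c).target := by
  have hg := continuousOn_gram hσ J hF.1 c
  have hh := continuousOn_gram hη J hF.1 c
  have ha := ((hg 0 0).mul (hg 1 1)).sub ((hg 0 1).mul (hg 0 1))
  refine (continuousOn_chartPartition c c).mul (ContinuousOn.div ?_
    (continuousOn_const.mul (ha.mul ha.sqrt)) fun y hy => ?_)
  · exact ((continuousOn_const.mul ha).mul (((hh 0 0).mul (hh 1 1)).sub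
      ((hh 0 1).mul (hh 0 1)))).sub (((((hg 0 0).mul (hh 1 1)).add ((hh 0 0).mul (hg 1 1))).sub
      (((hg 0 1).mul (hh 0 1)).add ((hh 0 1).mul (hg 0 1)))).pow 2)
  · have h := (gram_det_pos_of_tames hJ hF hy).2
    rw [gram_comm σ J F c y 1 0] at h
    have := Real.sqrt_pos.2 h
    positivity

omit [IsManifold (𝓡 m) ∞ M] in
-- The numerator is minus the discriminant of the pencil G + tH with G definite, whatever η is. This
-- sign is what rules out compensation between different parts of the surface.
lemma secondDensity_nonpos {σ η : DForm m M 2}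
    {J : AlmostComplexStructure m M} (hJ : Tames σ J) {F : S → M}
    (hF : IsSmoothImmersion (m := m) F) (c : S) {y : E 2} (hy : y ∈ (chart (m := 2) c).target) :
    secondDensity σ η J F c y ≤ 0 := by
  obtain ⟨hg, h⟩ := gram_det_pos_of_tames hJ hF hy
  rw [gram_comm σ J F c y 1 0] at h
  have hs := Real.sqrt_pos.2 h
  refine mul_nonpos_of_nonneg_of_nonpos ((chartPartition S).nonneg c _) ?_
  exact div_nonpos_of_nonpos_of_nonneg (sub_nonpos.2 (pencil_discrim_nonneg hg h)) (by positivity)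

/-- The second variation of the area of a compact region along an affine path of potentials. -/
lemma iteratedDeriv_areaFunctional {Ω : DForm m M 2} (hΩ : Ω.IsSmooth)
    {J : AlmostComplexStructure m M} {F : S → M} (hF : IsSmoothImmersion (m := m) F)
    {ρ f : M → ℝ} (hρ : ρ ∈ potentials Ω J) (hf : ContMDiff (𝓡 m) 𝓘(ℝ, ℝ) ∞ f)
    {K : Set S} (hK : IsCompact K) :
    iteratedDeriv 2 (fun t : ℝ => areaFunctional Ω J F K fun x => ρ x + t * f x) 0 =
      ∑ c ∈ (finite_chartPiece_nonempty hK).toFinset,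
        ∫ y in chartPiece K c, secondDensity (deform Ω J ρ) ((dc J f).d) J F c y := by
  set σ := deform Ω J ρ with hσ
  set η := (dc J f).d
  have hσs : σ.IsSmooth := deform_isSmooth hΩ J hρ.1
  have hηs : η.IsSmooth := (dc_isSmooth J hf).d
  have hg := fun c => continuousOn_gram hσs J hF.1 c
  have hh := fun c => continuousOn_gram hηs J hF.1 c
  have hsub : ∀ c, chartPiece K c ⊆ (chart (m := 2) c).target := fun c y hy =>
    (chartPiece_subset K c hy).1
  -- The Gram matrix is affine in t, so its determinant is exactly quadratic and no remainder has to
  -- be estimated.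
  have hdens : ∀ (t : ℝ) (c : S) (y : E 2),
      areaDensity (pullbackMetric F (metric (deform Ω J fun x => ρ x + t * f x) J)) c y =
      √((gram σ J F c y 0 0 * gram σ J F c y 1 1 - gram σ J F c y 0 1 * gram σ J F c y 0 1) +
        (gram σ J F c y 0 0 * gram η J F c y 1 1 + gram η J F c y 0 0 * gram σ J F c y 1 1 -
          (gram σ J F c y 0 1 * gram η J F c y 0 1 + gram η J F c y 0 1 * gram σ J F c y 0 1)) * t +
        (gram η J F c y 0 0 * gram η J F c y 1 1 - gram η J F c y 0 1 * gram η J F c y 0 1) *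
          t ^ 2) := by
    intro t c y
    have hlin : ∀ i j, gram (deform Ω J fun x => ρ x + t * f x) J F c y i j =
        gram σ J F c y i j + t * gram η J F c y i j := by
      intro i j
      unfold gram
      rw [deform_add_smul Ω J hρ.1 hf, symForm_add_smul]
    rw [areaDensity_eq_gram]
    simp only [hlin]
    rw [gram_comm σ J F c y 1 0, gram_comm η J F c y 1 0]
    congr 1
    ring
  have ha := fun c => ((hg c 0 0).mul (hg c 1 1)).sub ((hg c 0 1).mul (hg c 0 1))
  have hb := fun c => (((hg c 0 0).mul (hh c 1 1)).add ((hh c 0 0).mul (hg c 1 1))).sub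
      (((hg c 0 1).mul (hh c 0 1)).add ((hh c 0 1).mul (hg c 0 1)))
  have hc := fun c => ((hh c 0 0).mul (hh c 1 1)).sub ((hh c 0 1).mul (hh c 0 1))
  have harea : ∀ t : ℝ, areaFunctional Ω J F K (fun x => ρ x + t * f x) =
      ∑ c ∈ (finite_chartPiece_nonempty hK).toFinset, ∫ y in chartPiece K c,
        chartPartition S c ((chart (m := 2) c).symm y) * √(
        (gram σ J F c y 0 0 * gram σ J F c y 1 1 - gram σ J F c y 0 1 * gram σ J F c y 0 1) +
        (gram σ J F c y 0 0 * gram η J F c y 1 1 + gram η J F c y 0 0 * gram σ J F c y 1 1 -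
          (gram σ J F c y 0 1 * gram η J F c y 0 1 + gram η J F c y 0 1 * gram σ J F c y 0 1)) * t +
        (gram η J F c y 0 0 * gram η J F c y 1 1 - gram η J F c y 0 1 * gram η J F c y 0 1) *
          t ^ 2) := by
    intro t
    unfold areaFunctional
    rw [toReal_area hK]
    · simp only [hdens]
    · intro c
      refine ContinuousOn.congr ?_ fun y _ => hdens t c y
      exact (((ha c).add ((hb c).mul continuousOn_const)).add
        ((hc c).mul continuousOn_const)).sqrt
  refine HasSecondDerivAtZero.iteratedDeriv_eq (HasSecondDerivAtZero.congr
    (HasSecondDerivAtZero.sum _ fun c _ => ?_) (Eventually.of_forall harea))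
  refine hasSecondDerivAtZero_integral_sqrt (isCompact_chartPiece hK c)
    ((continuousOn_chartPartition c c).mono (hsub c)) ((ha c).mono (hsub c))
    ((hb c).mono (hsub c)) ((hc c).mono (hsub c)) fun y hy => ?_
  have h := (gram_det_pos_of_tames hρ.2 hF (hsub c hy)).2
  rwa [gram_comm _ J F c y 1 0] at h

/-- If the second area density is negative at one point, the second variation of area along
`ρ + t f` is negative. -/
lemma secondVariation_neg {Ω : DForm m M 2} (hΩ : Ω.IsSmooth)
    {J : AlmostComplexStructure m M} {F : S → M} (hF : IsSmoothImmersion (m := m) F)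
    {ρ f : M → ℝ} (hρ : ρ ∈ potentials Ω J) (hf : ContMDiff (𝓡 m) 𝓘(ℝ, ℝ) ∞ f)
    {c : S} {y₀ : E 2} (hy₀ : y₀ ∈ (chart (m := 2) c).target)
    (hneg : secondDensity (deform Ω J ρ) ((dc J f).d) J F c y₀ < 0) :
    secondVariation Ω J F (fun t x => ρ x + t * f x) < 0 := by
  set k := secondDensity (deform Ω J ρ) ((dc J f).d) J F with hk
  set T := (chart (m := 2) c).target
  have hT : IsOpen T := isOpen_extChartAt_target c
  have hkc : ∀ c, ContinuousOn (k c) (chart (m := 2) c).target := fun c =>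
    continuousOn_secondDensity (deform_isSmooth hΩ J hρ.1) (dc_isSmooth J hf).d hρ.2 hF c
  have hk0 : ∀ c, ∀ y ∈ (chart (m := 2) c).target, k c y ≤ 0 := fun c y hy =>
    secondDensity_nonpos hρ.2 hF c hy
  have hev : ∀ᶠ y in 𝓝 y₀, y ∈ T ∧ k c y < k c y₀ / 2 :=
    Filter.Eventually.and (hT.mem_nhds hy₀) (((hkc c).continuousAt (hT.mem_nhds hy₀)).eventually
      (gt_mem_nhds (by linarith)))
  obtain ⟨r, hr, hB⟩ := Metric.nhds_basis_closedBall.eventually_iff.1 hev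
  set B := Metric.closedBall y₀ r
  have hBc : IsCompact B := isCompact_closedBall _ _
  have hBT : B ⊆ T := fun y hy => (hB hy).1
  -- K₀ carries a ball on which the density is below half its value at y₀. Every larger compact
  -- region then has second derivative at most δ, half that value times the volume of the ball.
  let K₀ : TopologicalSpace.Compacts S := ⟨(chart (m := 2) c).symm '' B,
    hBc.image_of_continuousOn ((continuousOn_extChartAt_symm c).mono hBT)⟩
  set δ : ℝ := k c y₀ / 2 * (volume B).toReal
  have hδ : δ < 0 := by
    refine mul_neg_of_neg_of_pos (by linarith) (ENNReal.toReal_pos ?_ hBc.measure_lt_top.ne)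
    exact (Metric.measure_closedBall_pos volume y₀ hr).ne'
  have hle : ∀ K : TopologicalSpace.Compacts S, K₀ ≤ K →
      iteratedDeriv 2 (fun t : ℝ => areaFunctional Ω J F (K : Set S) fun x => ρ x + t * f x) 0
        ≤ δ := by
    intro K hKK
    rw [iteratedDeriv_areaFunctional hΩ hF hρ hf K.isCompact]
    have hQ := fun c => isCompact_chartPiece K.isCompact c
    have hsub : ∀ c, chartPiece (K : Set S) c ⊆ (chart (m := 2) c).target := fun c y hy =>
      (chartPiece_subset _ c hy).1
    have hint : ∀ c, IntegrableOn (k c) (chartPiece (K : Set S) c) := fun c =>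
      ((hkc c).mono (hsub c)).integrableOn_compact (hQ c)
    have hBQ : B ⊆ chartPiece (K : Set S) c := by
      intro y hy
      refine (mem_chartPiece (hBT hy)).2 ⟨hKK (mem_image_of_mem _ hy), ?_⟩
      -- The density contains the partition function as a factor, so where it is negative that
      -- function is nonzero.
      refine subset_tsupport _ fun h0 => ?_
      have h1 := (hB hy).2
      have h2 : k c y = 0 := by simp only [hk, secondDensity, h0, zero_mul]
      linarith
    have hcs : c ∈ (finite_chartPiece_nonempty K.isCompact).toFinset := by
      simpa using! ⟨y₀, hBQ (Metric.mem_closedBall_self hr.le)⟩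
    have hnonpos : ∀ c, ∫ y in chartPiece (K : Set S) c, k c y ≤ 0 := fun c =>
      setIntegral_nonpos (hQ c).measurableSet fun y hy => hk0 c y (hsub c hy)
    calc ∑ c ∈ (finite_chartPiece_nonempty K.isCompact).toFinset,
          ∫ y in chartPiece (K : Set S) c, k c y
        ≤ ∫ y in chartPiece (K : Set S) c, k c y := by
          classical
          rw [← Finset.add_sum_erase _ _ hcs]
          have := Finset.sum_nonpos (s := (finite_chartPiece_nonempty K.isCompact).toFinset.erase c)
            fun c _ => hnonpos c
          linarith
      _ ≤ ∫ y in B, k c y := by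
          have h := setIntegral_mono_set (μ := volume) (hint c).neg
            (by
              filter_upwards [ae_restrict_mem (hQ c).measurableSet] with y hy
              simpa using hk0 c y (hsub c hy)) hBQ.eventuallyLE
          simp only [Pi.neg_apply, integral_neg] at h
          linarith
      _ ≤ ∫ _ in B, k c y₀ / 2 := setIntegral_mono_on ((hint c).mono_set hBQ)
          (integrableOn_const hBc.measure_lt_top.ne) hBc.measurableSet fun y hy => (hB hy).2.le
      _ = δ := by
          rw [setIntegral_const, smul_eq_mul, mul_comm]
          rfl
  refine lt_of_le_of_lt (b := ((δ : ℝ) : EReal)) ?_ (by exact_mod_cast hδ)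
  -- A bound by δ on all regions containing K₀ bounds the upper limit along the directed set.
  refine limsup_le_of_le (by isBoundedDefault) ?_
  filter_upwards [eventually_ge_atTop K₀] with K hK
  exact_mod_cast hle K hK

omit [IsManifold (𝓡 m) ∞ M] in
lemma isVariation_add_smul {Ω : DForm m M 2} {J : AlmostComplexStructure m M}
    {ρ f : M → ℝ} (hρ : ρ ∈ potentials Ω J) (hf : ContMDiff (𝓡 m) 𝓘(ℝ, ℝ) ∞ f)
    (hfc : HasCompactSupport f) {ε : ℝ}
    (hmem : ∀ t ∈ Ioo (-ε) ε, (fun x => ρ x + t * f x) ∈ potentials Ω J) :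
    IsVariation Ω J ρ ε fun t x => ρ x + t * f x := by
  have hd : ∀ x t, HasDerivAt (fun t : ℝ => ρ x + t * f x) (f x) t := fun x t => by
    simpa using ((hasDerivAt_id t).mul_const (f x)).const_add (ρ x)
  refine ⟨?_, hmem, by simp, ?_, ?_⟩
  · exact ((hρ.1.comp contMDiff_snd).add (contMDiff_fst.mul (hf.comp contMDiff_snd))).contMDiffOn
  · simpa only [(hd _ 0).deriv] using hfc
  · have h0 : (fun x => iteratedDeriv 2 (fun t : ℝ => ρ x + t * f x) 0) = fun _ => 0 := by
      funext x
      have h1 : deriv (fun t : ℝ => ρ x + t * f x) = fun _ => f x := funext fun t => (hd x t).deriv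
      rw [iteratedDeriv_succ, iteratedDeriv_one, h1]
      simp
    rw [h0]
    exact HasCompactSupport.zero

/-- `secondDensity` is weighted by the partition function, so the argument must run in a chart whose
weight is positive at the chosen point. -/
lemma exists_chartPartition_pos (p : S) :
    ∃ c : S, p ∈ (chart (m := 2) c).source ∧ 0 < chartPartition S c p := by
  obtain ⟨c, hc⟩ := (chartPartition S).exists_pos_of_mem (mem_univ p)
  exact ⟨c, tsupport_chartPartition_subset c (subset_tsupport _ hc.ne'), hc⟩

/-- In Y = aX + bAX the coefficient b is nonzero because Y is not a multiple of X. Hence AX lies in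
the span of X and Y, which is then A-stable; A² = −1 gives surjectivity. -/
lemma image_eq_of_mem_span {V : Type*} [AddCommGroup V] [Module ℝ V] {A : V → V}
    (hadd : ∀ v w, A (v + w) = A v + A w) (hsmul : ∀ (a : ℝ) v, A (a • v) = a • A v)
    (hA : ∀ v, A (A v) = -v) {X Y : V} (hXY : ∀ a : ℝ, Y ≠ a • X)
    (hY : Y ∈ Submodule.span ℝ {X, A X}) :
    A '' (Submodule.span ℝ {X, Y} : Set V) = Submodule.span ℝ {X, Y} := by
  have hsub : ∀ v ∈ Submodule.span ℝ {X, Y}, A v ∈ Submodule.span ℝ {X, Y} := by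
    obtain ⟨a, b, hab⟩ := Submodule.mem_span_pair.1 hY
    have hb : b ≠ 0 := fun h => hXY a (by rw [← hab, h]; simp)
    have hAX : A X = (-(b⁻¹ * a)) • X + b⁻¹ • Y := by
      rw [← hab, smul_add, smul_smul, smul_smul, inv_mul_cancel₀ hb]
      module
    have hX : A X ∈ Submodule.span ℝ {X, Y} :=
      Submodule.mem_span_pair.2 ⟨_, _, hAX.symm⟩
    have hAY : A Y = a • A X + (-b) • X := by
      rw [← hab, hadd, hsmul, hsmul, hA]
      module
    have hYm : A Y ∈ Submodule.span ℝ {X, Y} := by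
      rw [hAY]
      exact Submodule.add_mem _ (Submodule.smul_mem _ _ hX)
        (Submodule.smul_mem _ _ (Submodule.subset_span (by simp)))
    intro v hv
    obtain ⟨s, t, rfl⟩ := Submodule.mem_span_pair.1 hv
    rw [hadd, hsmul, hsmul]
    exact Submodule.add_mem _ (Submodule.smul_mem _ _ hX) (Submodule.smul_mem _ _ hYm)
  refine Subset.antisymm (image_subset_iff.2 hsub) fun v hv => ?_
  refine ⟨A (-v), hsub _ (Submodule.neg_mem _ hv), ?_⟩
  rw [hA, neg_neg]

omit [IsManifold (𝓡 m) ∞ M] [T2Space S] [SigmaCompactSpace S] in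
lemma range_mfderiv_eq_span {F : S → M} {c : S} {y : E 2} (hy : y ∈ (chart (m := 2) c).target) :
    range (mfderiv (𝓡 2) (𝓡 m) F ((chart (m := 2) c).symm y)) =
      (Submodule.span ℝ {frame (m := m) F c y 0, frame F c y 1} : Set _) := by
  ext v
  rw [SetLike.mem_coe, Submodule.mem_span_pair]
  let D : E 2 →L[ℝ] E m := ContinuousLinearMap.comp
    (mfderiv (𝓡 2) (𝓡 m) F ((chart (m := 2) c).symm y))
    (mfderiv (𝓡 2) (𝓡 2) (chart (m := 2) c).symm y)
  have hD : ∀ a b : ℝ, D (a • EuclideanSpace.single 0 (1 : ℝ) + b • EuclideanSpace.single 1 (1 : ℝ))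
      = a • frame (m := m) F c y 0 + b • frame F c y 1 := fun a b => by
    rw [map_add, map_smul, map_smul]; rfl
  constructor
  · rintro ⟨u, rfl⟩
    set u' : E 2 := mfderiv (𝓡 2) (𝓡 2) (chart (m := 2) c) ((chart (m := 2) c).symm y) u
    have h1 : u' = u' 0 • EuclideanSpace.single 0 (1 : ℝ) +
        u' 1 • EuclideanSpace.single 1 (1 : ℝ) := by
      ext i; fin_cases i <;> simp
    refine ⟨u' 0, u' 1, ?_⟩
    refine ((hD _ _).symm.trans (congrArg D h1.symm)).trans ?_
    exact congrArg (mfderiv (𝓡 2) (𝓡 m) F ((chart (m := 2) c).symm y))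
      (mfderiv_symm_mfderiv_chart c hy u)
  · rintro ⟨a, b, rfl⟩
    exact ⟨_, hD a b⟩

omit [IsManifold (𝓡 m) ∞ M] in
lemma secondDensity_neg_of_gram {σ η : DForm m M 2} {J : AlmostComplexStructure m M}
    (hJ : Tames σ J) {F : S → M} (hF : IsSmoothImmersion (m := m) F) {c : S} {y : E 2}
    (hy : y ∈ (chart (m := 2) c).target)
    (hc : 0 < chartPartition S c ((chart (m := 2) c).symm y))
    (h0 : gram η J F c y 0 0 = 0) (h1 : gram η J F c y 1 1 ≠ 0) :
    secondDensity σ η J F c y < 0 := by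
  obtain ⟨hg, h⟩ := gram_det_pos_of_tames hJ hF hy
  rw [gram_comm σ J F c y 1 0] at h
  have hs := Real.sqrt_pos.2 h
  refine mul_neg_of_pos_of_neg hc (div_neg_of_neg_of_pos (sub_neg.2 ?_) (by positivity))
  rw [h0]
  exact pencil_discrim_pos hg h h1

/-- At a point where the tangent plane of the surface is not `J`-invariant there is a test function
along which the second area density is negative. -/
lemma exists_test_function_neg [T2Space M] {σ : DForm m M 2} {J : AlmostComplexStructure m M}
    (hJ : Tames σ J) {F : S → M} (hF : IsSmoothImmersion (m := m) F) {c : S} {y : E 2}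
    (hy : y ∈ (chart (m := 2) c).target)
    (hc : 0 < chartPartition S c ((chart (m := 2) c).symm y))
    (hinv : J (F ((chart (m := 2) c).symm y)) ''
      range (mfderiv (𝓡 2) (𝓡 m) F ((chart (m := 2) c).symm y)) ≠
        range (mfderiv (𝓡 2) (𝓡 m) F ((chart (m := 2) c).symm y))) :
    ∃ f : M → ℝ, ContMDiff (𝓡 m) 𝓘(ℝ, ℝ) ∞ f ∧ HasCompactSupport f ∧
      secondDensity σ ((dc J f).d) J F c y < 0 := by
  set x₀ := F ((chart (m := 2) c).symm y)
  set X := frame (m := m) F c y 0 with hX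
  set Y := frame (m := m) F c y 1 with hY
  have hXY : ∀ a : ℝ, Y ≠ a • X := fun a h => by
    have := frame_independent hF hy (a := -a) (b := 1) (by rw [← hX, ← hY, h]; simp)
    simp at this
  have hspan : Y ∉ Submodule.span ℝ {X, J x₀ X} := fun h => hinv (by
    rw [range_mfderiv_eq_span hy]
    exact image_eq_of_mem_span (map_add _) (map_smul _) (J.sq x₀) hXY h)
  -- A linear form vanishing on the J-invariant plane of X but not at Y: it makes the XX entry of H
  -- zero and the YY entry positive.
  obtain ⟨l, hlY, hl⟩ := Submodule.exists_le_ker_of_notMem hspan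
  have hlX : l X = 0 := hl (Submodule.subset_span (by simp))
  have hlJX : l (J x₀ X) = 0 := hl (Submodule.subset_span (by simp))
  -- Continuity is automatic in finite dimension.
  let l' : E m →L[ℝ] ℝ := LinearMap.toContinuousLinearMap (E := E m) l
  obtain ⟨f, hf, hfc, hfl⟩ := exists_test_function J x₀ l'
  refine ⟨f, hf, hfc, secondDensity_neg_of_gram hJ hF hy hc ?_ ?_⟩
  · have h1 : gram (dc J f).d J F c y 0 0 = l X ^ 2 + l (J x₀ X) ^ 2 :=
      (symForm_self _ _ _).trans (hfl X)
    rw [h1, hlX, hlJX]; simp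
  · have h1 : gram (dc J f).d J F c y 1 1 = l Y ^ 2 + l (J x₀ Y) ^ 2 :=
      (symForm_self _ _ _).trans (hfl Y)
    rw [h1]
    positivity

/-- A surface which is not `J`-holomorphic admits no stable point. -/
theorem IsStablePoint.isJHolomorphic [T2Space M] {Ω : DForm m M 2} (hΩ : Ω.IsSmooth)
    {J : AlmostComplexStructure m M} {F : S → M} (hF : IsSmoothImmersion (m := m) F)
    {ρ : M → ℝ} (hρ : IsStablePoint Ω J F ρ) : IsJHolomorphic J F := by
  intro p
  by_contra hinv
  obtain ⟨c, hpc, hc⟩ := exists_chartPartition_pos p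
  obtain ⟨y, hy, rfl⟩ : ∃ y ∈ (chart (m := 2) c).target, (chart (m := 2) c).symm y = p :=
    ⟨_, (chart (m := 2) c).map_source hpc, (chart (m := 2) c).left_inv hpc⟩
  obtain ⟨f, hf, hfc, hneg⟩ := exists_test_function_neg hρ.1.2 hF hy hc hinv
  obtain ⟨ε, hε, hmem⟩ := exists_add_smul_mem_potentials hΩ J hρ.1 hf hfc
  exact (secondVariation_neg hΩ hF hρ.1 hf hy hneg).not_ge
    (hρ.2 ε _ hε (isVariation_add_smul hρ.1 hf hfc hmem))

end Stability

end SymplecticArea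

end

theorem theorem3p4 (n : ℕ)
    {M : Type*} [TopologicalSpace M] [T2Space M] [SecondCountableTopology M]
    [ChartedSpace (SymplecticArea.E (2 * n)) M] [IsManifold (𝓡 (2 * n)) ∞ M]
    [NoncompactSpace M]
    (Ω : SymplecticArea.DForm (2 * n) M 2) (hΩ : SymplecticArea.IsSymplectic Ω)
    (J : SymplecticArea.AlmostComplexStructure (2 * n) M)
    (hJ : SymplecticArea.Compatible Ω J)
    (hcomplete : SymplecticArea.IsCompleteMetric (SymplecticArea.metric Ω J))
    {S : Type*} [TopologicalSpace S] [T2Space S] [SigmaCompactSpace S]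
    [ChartedSpace (SymplecticArea.E 2) S] [IsManifold (𝓡 2) ∞ S]
    (F : S → M) (hF : SymplecticArea.IsSmoothImmersion (m := 2 * n) F)
    (hstable : ∃ ρ : M → ℝ, SymplecticArea.IsCompatibleStablePoint Ω J F ρ) :
    SymplecticArea.IsJHolomorphic J F := by
  obtain ⟨ρ, hρ, -⟩ := hstable
  exact SymplecticArea.IsStablePoint.isJHolomorphic hΩ.smooth hF hρ
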